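/- Fix a field $\mathbb K$; $b_j(T)=\dim_{\mathbb K}H_j(T;\mathbb K)$ is the $j$-th Betti number (singular homology). An $m$-dimensional tropical variety in $\mathbb R^n$ is a finite rational polyhedral complex of pure dimension $m$, with positive integer weights on its $m$-dimensional cells satisfying the balancing condition; it is a homology bouquet of spheres if $b_0=1$ and $b_j=0$ for $1\le j\le m-1$. A tropical rational function is a continuous function that is affine with integer linear part on each cell of some finite rational subdivision. Let $m,d\ge 1$. A construction pattern $K=\{X_1,\dots,X_d,D_0,\dots,D_d,f_1,\dots,f_d\}$ consists of connected $m$-dimensional tropical varieties $X_i\subset\mathbb R^n$, $(m-1)$-dimensional (possibly empty) tropical varieties $D_0,\dots,D_d$ with $D_{i-1},D_i\subset X_i$, and tropical rational functions $f_i:X_i\to\mathbb R$ with $\operatorname{div}_{X_i}(f_i)=D_i-D_{i-1}$, such that for $1\le i\le d-1$ the divisor $D_i$ is non-empty and $f_i(p)>f_{i+1}(p)$ for all $p\in D_i$. The floor composed tropical variety $X_K\subset\mathbb R^{n}\times\mathbb R$ is $$X_K=\mathcal W_0\cup\bigcup_{i=1}^d\left(\Gamma_{f_i}(X_i)\cup\mathcal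 W_i\right),$$ where $\Gamma_{f_i}(X_i)$ is the graph of $f_i$, $\mathcal W_0=\{(x,t):x\in D_0,\ t\ge f_1(x)\}$, $\mathcal W_d=\{(x,t):x\in D_d,\ t\le f_d(x)\}$ and $\mathcal W_i=\{(x,t):x\in D_i,\ f_{i+1}(x)\le t\le f_i(x)\}$ for $1\le i\le d-1$. Let $K$ be a construction pattern such that $X_1,\dots,X_d$ are homology bouquets of spheres (as varieties of dimension $m$) and $f_i(p)>f_j(p)$ for all $i<j$ and all $p\in X_i\cap X_j$. (1) If $m=1$, then $$b_1(X_K)=\sum_{i=1}^d b_1(X_i)+\sum_{i=1}^{d-1}\left(b_0(D_i)-1\right).$$ (2) If $m\ge 2$ and $D_1,\dots,D_{d-1}$ are homology bouquets of spheres (as varieties of dimension $m-1$), then $X_K$ is a homology bouquet of spheres (as a variety of dimension $m$) and $$b_m(X_K)=\sum_{i=1}^d b_m(X_i)+\sum_{i=1}^{d-1}b_{m-1}(D_i).$$ -/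

import Mathlib

namespace TropicalGeom

universe u
noncomputable section

/-! ### Rational polyhedra and polyhedral complexes in `ℝⁿ` -/

/-- The inclusion `ℤⁿ ⊆ ℝⁿ`. -/
def intVec {n : ℕ} (v : Fin n → ℤ) : Fin n → ℝ := fun i => (v i : ℝ)

/-- A rational polyhedron: the solution set of finitely many weak linear inequalities with
integer coefficients and arbitrary real constant terms. -/
def IsRationalPolyhedron {n : ℕ} (σ : Set (Fin n → ℝ)) : Prop :=
  ∃ (k : ℕ) (A : Fin k → Fin n → ℤ) (b : Fin k → ℝ),
    σ = {x | ∀ i, ∑ j, (A i j : ℝ) * x j ≤ b i}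

/-- The dimension of (the affine hull of) a subset of `ℝⁿ`. -/
def polyDim {n : ℕ} (σ : Set (Fin n → ℝ)) : ℕ := Module.finrank ℝ (vectorSpan ℝ σ)

/-- The lattice `Λ_σ` of integer vectors parallel to `σ`. -/
def lattice {n : ℕ} (σ : Set (Fin n → ℝ)) : Set (Fin n → ℤ) :=
  {v | intVec v ∈ vectorSpan ℝ σ}

/-- For a facet `τ` of a polyhedron `σ`: the integer vector `u` represents the primitive generator
of `Λ_σ / Λ_τ ≅ ℤ` that points from `τ` into `σ`. -/
def IsPrimitiveNormal {n : ℕ} (τ σ : Set (Fin n → ℝ)) (u : Fin n → ℤ) : Prop :=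
  u ∈ lattice σ ∧ (∀ v ∈ lattice σ, ∃ k : ℤ, v - k • u ∈ lattice τ) ∧
    ∃ x ∈ τ, ∃ ε : ℝ, 0 < ε ∧ x + ε • intVec u ∈ σ

/-- A finite rational polyhedral complex in `ℝⁿ` (possibly empty). The nonempty faces of a
polyhedron are its nonempty exposed subsets, the polyhedron itself included. -/
structure PolyhedralComplex (n : ℕ) where
  /-- the cells -/
  cells : Finset (Set (Fin n → ℝ))
  cell_nonempty : ∀ σ ∈ cells, σ.Nonempty
  cell_rational : ∀ σ ∈ cells, IsRationalPolyhedron σ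
  face_mem : ∀ σ ∈ cells, ∀ τ : Set (Fin n → ℝ), τ.Nonempty → IsExposed ℝ σ τ → τ ∈ cells
  inter_face : ∀ σ ∈ cells, ∀ τ ∈ cells, (σ ∩ τ).Nonempty → IsExposed ℝ σ (σ ∩ τ)

namespace PolyhedralComplex

variable {n : ℕ}

/-- The underlying set of a polyhedral complex. -/
def support (C : PolyhedralComplex n) : Set (Fin n → ℝ) := ⋃ σ ∈ C.cells, σ

open Classical in
/-- The `m`-dimensional cells that contain `τ`. -/
def facetsAround (C : PolyhedralComplex n) (m : ℕ) (τ : Set (Fin n → ℝ)) :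
    Finset (Set (Fin n → ℝ)) :=
  C.cells.filter fun σ => polyDim σ = m ∧ τ ⊆ σ

/-- Every cell of `C` is a union of cells of `S`. -/
def IsCutBy (C S : PolyhedralComplex n) : Prop :=
  ∀ σ ∈ C.cells, σ = ⋃ τ ∈ {τ | τ ∈ S.cells ∧ τ ⊆ σ}, τ

end PolyhedralComplex

/-! ### Tropical varieties and divisors of tropical rational functions -/

/-- An `m`-dimensional tropical variety in `ℝⁿ`: a finite rational polyhedral complex of pure
dimension `m` whose `m`-dimensional cells carry positive integer weights that satisfy the balancing
condition at every cell of codimension one. (Values of `weight` on other sets are irrelevant.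
The empty tropical variety is allowed in every dimension.) -/
structure TropicalVariety (n m : ℕ) extends PolyhedralComplex n where
  /-- the weights of the `m`-dimensional cells -/
  weight : Set (Fin n → ℝ) → ℕ
  pure : ∀ σ ∈ cells, ∃ τ ∈ cells, polyDim τ = m ∧ σ ⊆ τ
  weight_pos : ∀ σ ∈ cells, polyDim σ = m → 0 < weight σ
  balanced : ∀ τ ∈ cells, polyDim τ + 1 = m → ∀ u : Set (Fin n → ℝ) → (Fin n → ℤ),
    (∀ σ ∈ toPolyhedralComplex.facetsAround m τ, IsPrimitiveNormal τ σ (u σ)) →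
      ∑ σ ∈ toPolyhedralComplex.facetsAround m τ, (weight σ : ℤ) • u σ ∈ lattice τ

/-- The weight that a tropical variety of dimension `m` gives to a polyhedron `τ` of the same
dimension which is either contained in one of the `m`-dimensional cells, or has no relative
interior point on the variety (weight `0`). -/
def TropicalVariety.weightOn {n m : ℕ} (X : TropicalVariety n m) (τ : Set (Fin n → ℝ)) : ℕ :=
  ∑ σ ∈ X.facetsAround m τ, X.weight σ

/-- `f` restricts to a tropical rational function on `X` (a continuous, piecewise integer affine
function) with divisor `div_X(f) = D₊ - D₋`.

There is a finite rational subdivision `S` of `X` along whose cells `D₊` and `D₋` are cut, such that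
`f` is on each cell `σ` of `S` an affine function with integer linear part `a σ`, and such that for
every cell `τ` of `S` of codimension one the multiplicity of `D₊ - D₋` along `τ` is
`∑ w_σ a_σ(u_σ) - a_τ(∑ w_σ u_σ)`. The sums are over the facets `σ` of `S` adjacent to `τ`, with
weights inherited from `X` and primitive normal vectors `u_σ`. -/
def HasDivisor {n m : ℕ} (X : TropicalVariety n m) (f : (Fin n → ℝ) → ℝ)
    (Dpos Dneg : TropicalVariety n (m - 1)) : Prop :=
  ∃ (S : PolyhedralComplex n) (a : Set (Fin n → ℝ) → (Fin n → ℤ)),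
    S.support = X.support ∧ X.IsCutBy S ∧ Dpos.IsCutBy S ∧ Dneg.IsCutBy S ∧
    (∀ σ ∈ S.cells, ∃ c : ℝ, ∀ x ∈ σ, f x = ∑ j, (a σ j : ℝ) * x j + c) ∧
    ∀ τ ∈ S.cells, polyDim τ + 1 = m → ∀ u : Set (Fin n → ℝ) → (Fin n → ℤ),
      (∀ σ ∈ S.facetsAround m τ, IsPrimitiveNormal τ σ (u σ)) →
        ∑ σ ∈ S.facetsAround m τ, (X.weightOn σ : ℤ) * ∑ j, a σ j * u σ j
          - ∑ j, a τ j * (∑ σ ∈ S.facetsAround m τ, (X.weightOn σ : ℤ) • u σ) j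
        = (Dpos.weightOn τ : ℤ) - Dneg.weightOn τ

/-! ### Floor composition -/

/-- A construction pattern `{X₁, …, X_d, D₀, …, D_d, f₁, …, f_d}` of `m`-dimensional tropical
varieties in `ℝⁿ` (`m ≥ 1`). Only the indices `1, …, d` of `X` and `f`, the indices `0, …, d` of
`D`, and the values of `f i` on `X i` matter. -/
structure ConstructionPattern (n m d : ℕ) where
  /-- the varieties `X₁, …, X_d` -/
  X : ℕ → TropicalVariety n m
  /-- the effective divisors `D₀, …, D_d` -/
  D : ℕ → TropicalVariety n (m - 1)
  /-- the functions `f₁, …, f_d` -/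
  f : ℕ → (Fin n → ℝ) → ℝ
  one_le : 1 ≤ d
  connected : ∀ i ∈ Finset.Icc 1 d, IsConnected (X i).support
  subset_left : ∀ i ∈ Finset.Icc 1 d, (D (i - 1)).support ⊆ (X i).support
  subset_right : ∀ i ∈ Finset.Icc 1 d, (D i).support ⊆ (X i).support
  divisor : ∀ i ∈ Finset.Icc 1 d, HasDivisor (X i) (f i) (D i) (D (i - 1))
  nonempty : ∀ i ∈ Finset.Icc 1 (d - 1), (D i).support.Nonempty
  lt : ∀ i ∈ Finset.Icc 1 (d - 1), ∀ p ∈ (D i).support, f (i + 1) p < f i p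

/-- The graph `Γ_f(S)` in `ℝⁿ × ℝ`. -/
def graphOver {n : ℕ} (f : (Fin n → ℝ) → ℝ) (S : Set (Fin n → ℝ)) : Set ((Fin n → ℝ) × ℝ) :=
  {p | p.1 ∈ S ∧ p.2 = f p.1}

/-- The set `Γ_f(S)⁻ = Γ_f(S) - ℝ_{≥0} (0, …, 0, 1)`. -/
def graphDown {n : ℕ} (f : (Fin n → ℝ) → ℝ) (S : Set (Fin n → ℝ)) : Set ((Fin n → ℝ) × ℝ) :=
  {p | p.1 ∈ S ∧ p.2 ≤ f p.1}

/-- The set `Γ_f(S)⁺ = Γ_f(S) + ℝ_{≥0} (0, …, 0, 1)`. -/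
def graphUp {n : ℕ} (f : (Fin n → ℝ) → ℝ) (S : Set (Fin n → ℝ)) : Set ((Fin n → ℝ) × ℝ) :=
  {p | p.1 ∈ S ∧ f p.1 ≤ p.2}

namespace ConstructionPattern

variable {n m d : ℕ}

/-- The walls `W₀, …, W_d`. -/
def wall (K : ConstructionPattern n m d) (i : ℕ) : Set ((Fin n → ℝ) × ℝ) :=
  if i = 0 then graphUp (K.f 1) (K.D 0).support
  else if i = d then graphDown (K.f d) (K.D d).support
  else graphDown (K.f i) (K.D i).support ∩ graphUp (K.f (i + 1)) (K.D i).support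

/-- The (underlying set of the) floor composed tropical variety `X_K` in `ℝⁿ × ℝ = ℝⁿ⁺¹`. -/
def floorComposed (K : ConstructionPattern n m d) : Set ((Fin n → ℝ) × ℝ) :=
  K.wall 0 ∪ ⋃ i ∈ Finset.Icc 1 d, (graphOver (K.f i) (K.X i).support ∪ K.wall i)

end ConstructionPattern

/-! ### Betti numbers -/

open AlgebraicTopology in
/-- The `j`-th Betti number of a topological space over a field `𝕜`: the dimension (in `ℕ∞`) of the
`j`-th singular homology group with coefficients in `𝕜`. -/
def betti (𝕜 : Type u) [Field 𝕜] (j : ℕ) (T : Type) [TopologicalSpace T] : ℕ∞ :=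
  Cardinal.toENat (Module.rank 𝕜
    (((singularHomologyFunctor.{0} (ModuleCat.{u} 𝕜) j).obj (ModuleCat.of 𝕜 𝕜)).obj (TopCat.of T)))

/-- The space `T`, thought of as an `m`-dimensional tropical variety, is a homology bouquet of
spheres (over `𝕜`): `b₀(T) = 1` and `b_j(T) = 0` for `1 ≤ j ≤ m - 1`. -/
def IsHomologyBouquet (𝕜 : Type u) [Field 𝕜] (m : ℕ) (T : Type) [TopologicalSpace T] : Prop :=
  betti 𝕜 0 T = 1 ∧ ∀ j : ℕ, 1 ≤ j → j < m → betti 𝕜 j T = 0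

end

end TropicalGeom

open CategoryTheory

namespace TropicalGeom

universe u
noncomputable section

/-! ### Affine simplices and barycentric subdivision -/

/-! The space is a stack of floors joined by vertical walls, and it is assembled from the top down.
The unbounded walls over D_0 and D_d collapse vertically onto their edges (`betti_floorComposed`).
For the rest, let Y be the union of the first i+1 floors and the walls between them, and let G be
the next floor, the graph of f_{i+2}. The hypothesis on heights puts G strictly below Y over every
common base point, and the wall between them meets Y and G only in its top and bottom edges.
Removing G, respectively Y, from the union leaves two relatively open sets that retract vertically
onto Y, respectively G. They meet in the open wall, which retracts onto a copy of D = D_{i+1}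
(`exists_wall_cover`, `exists_floors_cover`).

Mayer-Vietoris does the counting. Since D has dimension m-1, H_m(D) = 0
(`TropicalVariety.betti_eq_zero`), so b_m of the union is b_m(Y) + b_m(G) plus the dimension of the
kernel of H_{m-1}(D) → H_{m-1}(Y) ⊕ H_{m-1}(G) (`betti_union`). For m = 1 this kernel is the reduced
H_0 of D, because Y and G are path connected. For m ≥ 2 the target vanishes by the bouquet property,
so all of H_{m-1}(D) contributes; in degrees 1 to m-1 the same sequence gives vanishing, where
degree one uses that D is path connected. Induction on the number of floors finishes the proof.

Two topological inputs are established on the way. Mayer-Vietoris rests on the theorem of small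
simplices (`exists_sub_bd_mem_smallChain`): barycentric subdivision and its chain homotopy are built
once as universal affine chains, which act on singular chains by precomposition. Vanishing above the
dimension comes from removing the cells of a polyhedral complex one by one and covering by open
stars (`PolyhedralComplex.betti_stars`). -/

/-- The standard topological `n`-simplex. -/
abbrev Simp (n : ℕ) : Type := stdSimplex ℝ (Fin (n + 1))

/-- The convex combination of the points `w` with weights `t`. -/
def mix {k n : ℕ} (t : Simp k) (w : Fin (k + 1) → Simp n) : Simp n :=
  ⟨fun c => ∑ a, t a * w a c, fun c => Finset.sum_nonneg fun a _ => mul_nonneg (t.2.1 a) ((w a).2.1 c),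
    by
      rw [Finset.sum_comm]
      simp [← Finset.mul_sum]⟩

lemma mix_apply {k n : ℕ} (t : Simp k) (w : Fin (k + 1) → Simp n) (c : Fin (n + 1)) :
    mix t w c = ∑ a, t a * w a c := rfl

lemma mix_vertex {k n : ℕ} (i : Fin (k + 1)) (w : Fin (k + 1) → Simp n) :
    mix (stdSimplex.vertex i) w = w i := by
  ext c
  simp [mix_apply, Pi.single_apply]

lemma mix_vertices {k : ℕ} (t : Simp k) : mix t (fun i => stdSimplex.vertex i) = t := by
  ext c
  simp [mix_apply, Pi.single_apply]

lemma mix_mix {k n m : ℕ} (t : Simp k) (w : Fin (k + 1) → Simp n) (v : Fin (n + 1) → Simp m) :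
    mix (mix t w) v = mix t (fun i => mix (w i) v) := by
  ext c
  simp only [mix_apply, Finset.sum_mul, Finset.mul_sum]
  rw [Finset.sum_comm]
  simp [mul_assoc]

/-- The category of affine maps between standard simplices. -/
structure AffSimp where
  /-- the dimension of the simplex -/
  dim : ℕ

/-- A morphism is the list of the images of the vertices, so that forming a cone is just prepending
a point. The actual affine map is recovered by `affMap`. -/
instance : Category AffSimp where
  Hom k n := Fin (k.dim + 1) → Simp n.dim
  id k := fun i => stdSimplex.vertex i
  comp w v := fun i => mix (w i) v
  id_comp w := by funext i; exact mix_vertex i w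
  comp_id w := by funext i; exact mix_vertices (w i)
  assoc w v u := by funext i; exact mix_mix (w i) v u

lemma affSimp_comp_apply {k n m : AffSimp} (w : k ⟶ n) (v : n ⟶ m) (i : Fin (k.dim + 1)) :
    (w ≫ v) i = mix (w i) v := rfl

/-- The face inclusions as affine maps. -/
def face (k : ℕ) (i : Fin (k + 2)) : AffSimp.mk k ⟶ AffSimp.mk (k + 1) :=
  fun j => stdSimplex.vertex (i.succAbove j)

lemma face_comp {k : ℕ} {n : AffSimp} (i : Fin (k + 2)) (w : AffSimp.mk (k + 1) ⟶ n) :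
    face k i ≫ w = fun j => w (i.succAbove j) := by
  funext j
  exact mix_vertex _ w

lemma mix_face {k : ℕ} (i : Fin (k + 2)) (t : Simp k) :
    mix t (face k i) = stdSimplex.map i.succAbove t := by
  ext c
  rw [mix_apply, stdSimplex.map_coe, FunOnFinite.linearMap_apply_apply, Finset.sum_filter]
  refine Finset.sum_congr rfl fun a _ => ?_
  simp only [face, stdSimplex.vertex_coe, Pi.single_apply]
  by_cases h : i.succAbove a = c
  · simp [h]
  · simp [h, Ne.symm h]

/-- The cosimplicial object of affine simplices. -/
def affCosimplicial : SimplexCategory ⥤ AffSimp where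
  obj n := ⟨n.len⟩
  map f := fun i => stdSimplex.vertex (f.toOrderHom i)
  map_id _ := rfl
  map_comp f g := by
    funext i
    exact (mix_vertex (f.toOrderHom i) fun i => stdSimplex.vertex (g.toOrderHom i)).symm

variable (𝕜 : Type u) [Field 𝕜]

/-- The object of dimension `k` in the linearization of the category of affine simplices. -/
abbrev ob (k : ℕ) : Free 𝕜 AffSimp := Free.of 𝕜 (AffSimp.mk k)

variable {𝕜} in
/-- An affine simplex as a chain. -/
def aff {k n : ℕ} (w : AffSimp.mk k ⟶ AffSimp.mk n) : ob 𝕜 k ⟶ ob 𝕜 n := Finsupp.single w (1 : 𝕜)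

lemma aff_comp {k n m : ℕ} (w : AffSimp.mk k ⟶ AffSimp.mk n) (v : AffSimp.mk n ⟶ AffSimp.mk m) :
    (aff w ≫ aff v : ob 𝕜 k ⟶ ob 𝕜 m) = aff (w ≫ v) := by
  refine (Free.single_comp_single 𝕜 AffSimp w v 1 1).trans ?_
  rw [one_mul]
  rfl

lemma aff_id (k : ℕ) : (aff (𝟙 (AffSimp.mk k)) : ob 𝕜 k ⟶ ob 𝕜 k) = 𝟙 _ := rfl

variable {𝕜} in
lemma chain_induction {k n : ℕ} {p : (ob 𝕜 k ⟶ ob 𝕜 n) → Prop} (c : ob 𝕜 k ⟶ ob 𝕜 n)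
    (h0 : p 0) (hadd : ∀ a b, p a → p b → p (a + b))
    (hs : ∀ (r : 𝕜) (w : AffSimp.mk k ⟶ AffSimp.mk n), p (r • aff w)) : p c := by
  refine Finsupp.induction_linear (motive := p) c h0 hadd fun w r => ?_
  have := hs r w
  unfold aff at this
  erw [Finsupp.smul_single, smul_eq_mul, mul_one] at this
  exact this

/-! ### Boundary, cones and subdivision of universal affine chains. -/

/-- The boundary of the identity of the `k+1`-simplex. -/
def bd (k : ℕ) : ob 𝕜 k ⟶ ob 𝕜 (k + 1) :=
  ∑ i : Fin (k + 2), (-1 : ℤ) ^ (i : ℕ) • aff (face k i)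

/-- `bd` is the alternating coface differential of the standard cosimplicial object, linearized. -/
lemma bd_bd (k : ℕ) : bd 𝕜 k ≫ bd 𝕜 (k + 1) = 0 :=
  AlgebraicTopology.AlternatingCofaceMapComplex.d_squared
    (affCosimplicial ⋙ Free.embedding 𝕜 AffSimp) k

/-- The cone with apex `b` over an affine simplex. -/
def consSimp {k n : ℕ} (b : Simp n) (w : AffSimp.mk k ⟶ AffSimp.mk n) :
    AffSimp.mk (k + 1) ⟶ AffSimp.mk n := Fin.cons (α := fun _ => Simp n) b w

variable {𝕜} in
/-- The cone with apex `b` over an affine chain. -/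
def cone {k n : ℕ} (b : Simp n) : (ob 𝕜 k ⟶ ob 𝕜 n) →ₗ[𝕜] (ob 𝕜 (k + 1) ⟶ ob 𝕜 n) :=
  Finsupp.lmapDomain 𝕜 𝕜 (consSimp b)

lemma cone_aff {k n : ℕ} (b : Simp n) (w : AffSimp.mk k ⟶ AffSimp.mk n) :
    cone b (aff w : ob 𝕜 k ⟶ ob 𝕜 n) = aff (consSimp b w) :=
  Finsupp.mapDomain_single

lemma face_zero_cons {k n : ℕ} (b : Simp n) (w : AffSimp.mk k ⟶ AffSimp.mk n) :
    face k 0 ≫ consSimp b w = w := by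
  rw [face_comp]
  funext j
  rfl

lemma face_succ_cons {k n : ℕ} (b : Simp n) (w : AffSimp.mk (k + 1) ⟶ AffSimp.mk n)
    (i : Fin (k + 2)) :
    face (k + 1) i.succ ≫ consSimp b w = consSimp b (face k i ≫ w) := by
  rw [face_comp, face_comp]
  funext j
  refine Fin.cases ?_ (fun j => ?_) j
  · rw [Fin.succ_succAbove_zero]; rfl
  · rw [Fin.succ_succAbove_succ]; rfl

variable {𝕜} in
/-- The boundary of a cone in positive degrees. -/
lemma bd_cone {k n : ℕ} (b : Simp n) (c : ob 𝕜 (k + 1) ⟶ ob 𝕜 n) :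
    bd 𝕜 (k + 1) ≫ cone b c = c - cone b (bd 𝕜 k ≫ c) := by
  induction c using chain_induction with
  | h0 => simp
  | hadd a b ha hb => rw [map_add, Preadditive.comp_add, ha, hb, Preadditive.comp_add, map_add]; abel
  | hs r w =>
    rw [map_smul, Linear.comp_smul, Linear.comp_smul, map_smul, ← smul_sub]
    congr 1
    -- Face zero of a cone is its base; face i+1 is the cone over face i of the base, with the
    -- opposite sign.
    rw [cone_aff, bd, Preadditive.sum_comp, Fin.sum_univ_succ, bd, Preadditive.sum_comp, map_sum,
      sub_eq_add_neg, ← Finset.sum_neg_distrib]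
    congr 1
    · simp only [Preadditive.zsmul_comp, aff_comp, face_zero_cons]
      simp
    · refine Finset.sum_congr rfl fun i _ => ?_
      simp only [Preadditive.zsmul_comp, aff_comp, face_succ_cons, map_zsmul, cone_aff]
      simp [pow_succ]

variable {𝕜} in
/-- The boundary of a cone over a `0`-chain that is a boundary of the identity. -/
lemma bd_cone_bd_zero (b : Simp 1) :
    bd 𝕜 0 ≫ cone b (bd 𝕜 0) = bd 𝕜 0 := by
  -- Over a 0-simplex the other face of the cone is the apex itself; the two apex terms cancel in
  -- the difference.
  have h : ∀ w : AffSimp.mk 0 ⟶ AffSimp.mk 1, face 0 1 ≫ consSimp b w = fun _ => b := by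
    intro w
    rw [face_comp]
    funext j
    obtain rfl : j = 0 := Fin.fin_one_eq_zero j
    rfl
  have e : bd 𝕜 0 = aff (face 0 0) - aff (face 0 1) := by
    simp [bd, Fin.sum_univ_two, sub_eq_add_neg]
  rw [e, map_sub, cone_aff, cone_aff, Preadditive.comp_sub, Preadditive.sub_comp,
    Preadditive.sub_comp]
  simp only [aff_comp, face_zero_cons, h]
  abel

/-- The barycentric subdivision of the identity of the `n`-simplex. -/
def sd : (n : ℕ) → (ob 𝕜 n ⟶ ob 𝕜 n)
  | 0 => 𝟙 _
  | n + 1 => cone stdSimplex.barycenter (sd n ≫ bd 𝕜 n)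

/-- The boundary of a cone is its base minus the cone over the boundary of the base. The base `sd n
≫ bd n` is a cycle by induction and `bd_bd`, so only the base survives. Degree one is separate
because the cone formula there has apex terms. -/
lemma bd_sd (n : ℕ) : bd 𝕜 n ≫ sd 𝕜 (n + 1) = sd 𝕜 n ≫ bd 𝕜 n := by
  induction n with
  | zero =>
    have e : sd 𝕜 0 ≫ bd 𝕜 0 = bd 𝕜 0 := Category.id_comp _
    have h : sd 𝕜 1 = cone stdSimplex.barycenter (sd 𝕜 0 ≫ bd 𝕜 0) := rfl
    rw [h, e]
    exact bd_cone_bd_zero _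
  | succ n ih =>
    rw [sd, bd_cone, ← Category.assoc, ih, Category.assoc, bd_bd, Limits.comp_zero, map_zero,
      sub_zero]

/-- The chain homotopy from the identity to the barycentric subdivision. -/
def sdHomotopy : (n : ℕ) → (ob 𝕜 (n + 1) ⟶ ob 𝕜 n)
  | 0 => 0
  | n + 1 => cone stdSimplex.barycenter (𝟙 _ - sdHomotopy n ≫ bd 𝕜 n)

/-- Write T for the homotopy and ∂ for `bd`. Since T is the cone over 1 - T∂, its boundary is 1 - T∂
minus the cone over the boundary of 1 - T∂. By `key` that inner boundary is the base of the next
subdivision, so its cone is `sd`. -/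
lemma bd_sdHomotopy (n : ℕ) :
    bd 𝕜 (n + 1) ≫ sdHomotopy 𝕜 (n + 1) + sdHomotopy 𝕜 n ≫ bd 𝕜 n = 𝟙 _ - sd 𝕜 (n + 1) := by
  have key : bd 𝕜 n ≫ (𝟙 _ - sdHomotopy 𝕜 n ≫ bd 𝕜 n) = sd 𝕜 n ≫ bd 𝕜 n := by
    cases n with
    | zero => simp [sdHomotopy, sd]
    | succ n =>
      have ih := bd_sdHomotopy n
      have : bd 𝕜 (n + 1) ≫ sdHomotopy 𝕜 (n + 1)
          = 𝟙 _ - sd 𝕜 (n + 1) - sdHomotopy 𝕜 n ≫ bd 𝕜 n := by rw [← ih]; abel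
      rw [Preadditive.comp_sub, ← Category.assoc, this, Preadditive.sub_comp, Category.assoc, bd_bd,
        Preadditive.sub_comp]
      simp
  rw [sdHomotopy, bd_cone, key, sd]
  abel

end
end TropicalGeom

open CategoryTheory

namespace TropicalGeom

universe u
noncomputable section

/-! ### Small simplices -/

section Support

variable (𝕜 : Type u) [Field 𝕜]

/-- The affine chains that are combinations of simplices in `P`. -/
def affSpan {k n : ℕ} (P : Set (AffSimp.mk k ⟶ AffSimp.mk n)) :
    Submodule 𝕜 (ob 𝕜 k ⟶ ob 𝕜 n) := Submodule.span 𝕜 (aff '' P)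

variable {𝕜}

lemma aff_mem_affSpan {k n : ℕ} {P : Set (AffSimp.mk k ⟶ AffSimp.mk n)} {w} (h : w ∈ P) :
    aff w ∈ affSpan 𝕜 P := Submodule.subset_span ⟨w, h, rfl⟩

lemma comp_mem_affSpan {k n m : ℕ} {P : Set (AffSimp.mk k ⟶ AffSimp.mk n)}
    {Q : Set (AffSimp.mk n ⟶ AffSimp.mk m)} {R : Set (AffSimp.mk k ⟶ AffSimp.mk m)}
    (h : ∀ w ∈ P, ∀ v ∈ Q, w ≫ v ∈ R) {c : ob 𝕜 k ⟶ ob 𝕜 n} {e : ob 𝕜 n ⟶ ob 𝕜 m}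
    (hc : c ∈ affSpan 𝕜 P) (he : e ∈ affSpan 𝕜 Q) : c ≫ e ∈ affSpan 𝕜 R := by
  induction hc using Submodule.span_induction with
  | zero => simp
  | add x y _ _ hx hy => rw [Preadditive.add_comp]; exact add_mem hx hy
  | smul r x _ hx => rw [Linear.smul_comp]; exact Submodule.smul_mem _ _ hx
  | mem x hx =>
    obtain ⟨w, hw, rfl⟩ := hx
    induction he using Submodule.span_induction with
    | zero => simp
    | add x y _ _ hx hy => rw [Preadditive.comp_add]; exact add_mem hx hy
    | smul r x _ hx => rw [Linear.comp_smul]; exact Submodule.smul_mem _ _ hx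
    | mem y hy =>
      obtain ⟨v, hv, rfl⟩ := hy
      rw [aff_comp]
      exact aff_mem_affSpan (h w hw v hv)

lemma cone_mem_affSpan {k n : ℕ} {P : Set (AffSimp.mk k ⟶ AffSimp.mk n)}
    {Q : Set (AffSimp.mk (k + 1) ⟶ AffSimp.mk n)} (b : Simp n)
    (h : ∀ w ∈ P, consSimp b w ∈ Q) {c : ob 𝕜 k ⟶ ob 𝕜 n} (hc : c ∈ affSpan 𝕜 P) :
    cone b c ∈ affSpan 𝕜 Q := by
  induction hc using Submodule.span_induction with
  | zero => simp
  | add x y _ _ hx hy => rw [map_add]; exact add_mem hx hy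
  | smul r x _ hx => rw [map_smul]; exact Submodule.smul_mem _ _ hx
  | mem x hx =>
    obtain ⟨w, hw, rfl⟩ := hx
    rw [cone_aff]
    exact aff_mem_affSpan (h w hw)

/-- Affine simplices all of whose vertices have a common coordinate that is at least `δ`. -/
def minorized (k n : ℕ) (δ : ℝ) : Set (AffSimp.mk k ⟶ AffSimp.mk n) :=
  {w | ∃ j : Fin (n + 1), ∀ i : Fin (k + 1), δ ≤ (w i : Simp n) j}

/-- Affine simplices of sup-diameter at most `M`. -/
def smallAff (k n : ℕ) (M : ℝ) : Set (AffSimp.mk k ⟶ AffSimp.mk n) :=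
  {w | ∀ i l : Fin (k + 1), ∀ c : Fin (n + 1), (w i : Simp n) c - (w l : Simp n) c ≤ M}

lemma bd_mem_affSpan (n : ℕ) : bd 𝕜 n ∈ affSpan 𝕜 (Set.range (face n)) :=
  Submodule.sum_mem _ fun i _ => zsmul_mem (aff_mem_affSpan (Set.mem_range_self i)) _

/-- The vertices of a simplex of the subdivision are the barycentres of a flag of faces. All of
these faces contain the vertex with which the flag starts, so its coordinate is at least 1/(n+1) at
each barycentre. -/
lemma sd_mem_affSpan (n : ℕ) : sd 𝕜 n ∈ affSpan 𝕜 (minorized n n (1 / (n + 1))) := by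
  induction n with
  | zero =>
    refine aff_mem_affSpan (w := 𝟙 _) ⟨0, fun i => ?_⟩
    obtain rfl : i = 0 := Fin.fin_one_eq_zero i
    have : ((𝟙 (AffSimp.mk 0) : AffSimp.mk 0 ⟶ AffSimp.mk 0) 0 : Simp 0) =
      stdSimplex.vertex 0 := rfl
    rw [this]
    simp
  | succ n ih =>
    refine cone_mem_affSpan (P := minorized n (n + 1) (1 / (n + 1))) _ ?_
      (comp_mem_affSpan ?_ ih (bd_mem_affSpan n))
    · rintro w ⟨j, hj⟩
      refine ⟨j, fun i => ?_⟩
      refine Fin.cases ?_ (fun i => ?_) i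
      · change _ ≤ (stdSimplex.barycenter : Simp (n + 1)).val j
        rw [stdSimplex.barycenter_apply]
        simp
      · refine le_trans ?_ (hj i)
        push_cast
        gcongr
        linarith
    · rintro w ⟨j, hj⟩ _ ⟨i, rfl⟩
      refine ⟨i.succAbove j, fun l => (hj l).trans_eq ?_⟩
      rw [affSimp_comp_apply, mix_apply]
      simp [face, Pi.single_apply]

lemma sum_mul_sub_sum_mul_le {ι : Type*} [Fintype ι] {p q x : ι → ℝ} {M : ℝ}
    (hp : ∀ a, 0 ≤ p a) (hq : ∀ a, 0 ≤ q a) {s : ℝ} (hps : ∑ a, p a = s) (hqs : ∑ a, q a = s)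
    (hx : ∀ a b, x a - x b ≤ M) : ∑ a, p a * x a - ∑ a, q a * x a ≤ s * M := by
  have hs : 0 ≤ s := hps ▸ Finset.sum_nonneg fun a _ => hp a
  rcases isEmpty_or_nonempty ι with h | h
  · simp at hps
    simp [← hps]
  obtain ⟨b, hb⟩ := Finite.exists_min x
  have h1 : ∑ a, p a * x a ≤ ∑ a, p a * (x b + M) :=
    Finset.sum_le_sum fun a _ => mul_le_mul_of_nonneg_left (by linarith [hx a b]) (hp a)
  have h2 : ∑ a, q a * x b ≤ ∑ a, q a * x a :=
    Finset.sum_le_sum fun a _ => mul_le_mul_of_nonneg_left (hb a) (hq a)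
  rw [← Finset.sum_mul, hps] at h1
  rw [← Finset.sum_mul, hqs] at h2
  linarith

/-- All vertices of `w` give mass at least δ to the same vertex j. This common mass cancels in
differences, which leaves two combinations of total mass 1 - δ. Hence subdivision shrinks diameters
by a factor of at most 1 - 1/(n+1). -/
lemma minorized_comp_smallAff {k n m : ℕ} {δ M : ℝ} {w : AffSimp.mk k ⟶ AffSimp.mk n}
    {v : AffSimp.mk n ⟶ AffSimp.mk m} (hw : w ∈ minorized k n δ)
    (hv : v ∈ smallAff n m M) :
    w ≫ v ∈ smallAff k m ((1 - δ) * M) := by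
  obtain ⟨j, hj⟩ := hw
  intro i l c
  rw [affSimp_comp_apply, affSimp_comp_apply, mix_apply, mix_apply]
  have key := sum_mul_sub_sum_mul_le (p := fun a => (w i : Simp n) a - if a = j then δ else 0)
    (q := fun a => (w l : Simp n) a - if a = j then δ else 0) (x := fun a => (v a : Simp m) c)
    (M := M) (s := 1 - δ) ?_ ?_ ?_ ?_ (fun a b => hv a b c)
  · simp only [sub_mul, Finset.sum_sub_distrib] at key
    linarith
  · intro a
    dsimp only
    split_ifs with h
    · subst h; linarith [hj i]
    · simp
  · intro a
    dsimp only
    split_ifs with h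
    · subst h; linarith [hj l]
    · simp
  · rw [Finset.sum_sub_distrib, stdSimplex.sum_eq_one]; simp
  · rw [Finset.sum_sub_distrib, stdSimplex.sum_eq_one]; simp

variable (𝕜) in
/-- The iterated barycentric subdivision. -/
def sdPow (n : ℕ) : ℕ → (ob 𝕜 n ⟶ ob 𝕜 n)
  | 0 => 𝟙 _
  | k + 1 => sd 𝕜 n ≫ sdPow n k

lemma sdPow_mem_affSpan (n k : ℕ) :
    sdPow 𝕜 n k ∈ affSpan 𝕜 (smallAff n n ((1 - 1 / (n + 1)) ^ k)) := by
  induction k with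
  | zero =>
    refine aff_mem_affSpan (w := 𝟙 _) fun i l c => ?_
    rw [pow_zero]
    linarith [stdSimplex.le_one ((𝟙 (AffSimp.mk n) : AffSimp.mk n ⟶ AffSimp.mk n) i : Simp n) c,
      stdSimplex.zero_le ((𝟙 (AffSimp.mk n) : AffSimp.mk n ⟶ AffSimp.mk n) l : Simp n) c]
  | succ k ih =>
    refine comp_mem_affSpan ?_ (sd_mem_affSpan n) ih
    intro w hw v hv
    rw [pow_succ']
    exact minorized_comp_smallAff hw hv

end Support

/-! ### The action of affine chains on singular chains -/

/-- The continuous map given by an affine simplex. -/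
def affMap {k n : ℕ} (w : AffSimp.mk k ⟶ AffSimp.mk n) : C(Simp k, Simp n) where
  toFun t := mix t w
  continuous_toFun := by
    refine Continuous.subtype_mk (continuous_pi fun c => continuous_finsetSum _ fun a _ => ?_) _
    exact ((continuous_apply a).comp continuous_subtype_val).mul continuous_const

lemma affMap_comp {k n m : ℕ} (w : AffSimp.mk k ⟶ AffSimp.mk n) (v : AffSimp.mk n ⟶ AffSimp.mk m) :
    affMap (w ≫ v) = (affMap v).comp (affMap w) := by
  ext1 t
  exact (mix_mix t w v).symm

lemma affMap_id (k : ℕ) : affMap (𝟙 (AffSimp.mk k)) = .id _ := by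
  ext1 t
  exact mix_vertices t

lemma dist_affMap_le {k n : ℕ} {w : AffSimp.mk k ⟶ AffSimp.mk n} {M : ℝ} (hM : 0 ≤ M)
    (hw : w ∈ smallAff k n M) (s t : Simp k) : dist (affMap w s) (affMap w t) ≤ M := by
  have key : ∀ s t : Simp k, ∀ c, (affMap w s) c - (affMap w t) c ≤ M := by
    intro s t c
    have := sum_mul_sub_sum_mul_le (p := s) (q := t) (x := fun a => (w a : Simp n) c)
      (M := M) (s := 1) (by simp) (by simp) (by simp) (by simp) (fun a b => hw a b c)
    rwa [one_mul] at this
  rw [Subtype.dist_eq, dist_pi_le_iff hM]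
  intro c
  rw [Real.dist_eq, abs_le]
  have h1 := key s t c
  have h2 := key t s c
  change -M ≤ affMap w s c - affMap w t c ∧ affMap w s c - affMap w t c ≤ M
  constructor <;> linarith

section Action

variable {𝕜 : Type u} [Field 𝕜] {X : Type} [TopologicalSpace X]

variable (𝕜 X) in
/-- Singular chains of a topological space. -/
abbrev SingChain (n : ℕ) : Type u := C(Simp n, X) →₀ 𝕜

/-- The right action of affine chains on singular chains. -/
def act {k n : ℕ} : (ob 𝕜 k ⟶ ob 𝕜 n) →ₗ[𝕜] SingChain 𝕜 X n →ₗ[𝕜] SingChain 𝕜 X k :=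
  Finsupp.linearCombination 𝕜 (M := SingChain 𝕜 X n →ₗ[𝕜] SingChain 𝕜 X k)
    (fun w : AffSimp.mk k ⟶ AffSimp.mk n =>
    Finsupp.lmapDomain 𝕜 𝕜 fun σ : C(Simp n, X) => σ.comp (affMap w))

lemma act_aff {k n : ℕ} (w : AffSimp.mk k ⟶ AffSimp.mk n) (z : SingChain 𝕜 X n) :
    act (aff w) z = Finsupp.mapDomain (fun σ : C(Simp n, X) => σ.comp (affMap w)) z := by
  have : act (X := X) (aff w : ob 𝕜 k ⟶ ob 𝕜 n) =
      Finsupp.lmapDomain 𝕜 𝕜 fun σ : C(Simp n, X) => σ.comp (affMap w) := by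
    refine (Finsupp.linearCombination_single 𝕜 (1 : 𝕜) w).trans (one_smul 𝕜 _)
  rw [this]
  rfl

lemma act_id {n : ℕ} (z : SingChain 𝕜 X n) : act (𝟙 (ob 𝕜 n)) z = z := by
  rw [← aff_id, act_aff, affMap_id]
  exact Finsupp.mapDomain_id

lemma act_comp {k n m : ℕ} (a : ob 𝕜 k ⟶ ob 𝕜 n) (b : ob 𝕜 n ⟶ ob 𝕜 m) (z : SingChain 𝕜 X m) :
    act (a ≫ b) z = act a (act b z) := by
  induction a using chain_induction with
  | h0 => simp
  | hadd a b ha hb => simp only [Preadditive.add_comp, map_add, LinearMap.add_apply, ha, hb]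
  | hs r w =>
    rw [Linear.smul_comp, map_smul, map_smul, LinearMap.smul_apply, LinearMap.smul_apply]
    congr 1
    induction b using chain_induction with
    | h0 => simp
    | hadd a b ha hb => simp only [Preadditive.comp_add, map_add, LinearMap.add_apply, ha, hb]
    | hs r v =>
      rw [Linear.comp_smul, map_smul, map_smul, LinearMap.smul_apply, LinearMap.smul_apply,
        map_smul, aff_comp, act_aff, act_aff, act_aff, ← Finsupp.mapDomain_comp, affMap_comp]
      rfl

/-! ### Chains subordinate to a cover by two sets. -/

/-- The singular simplices that are contained in one of the sets `U` and `V`. -/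
def smallSing (U V : Set X) (n : ℕ) : Set C(Simp n, X) :=
  {σ | Set.range σ ⊆ U ∨ Set.range σ ⊆ V}

variable (𝕜) in
/-- The chains of singular simplices that are contained in one of the sets `U` and `V`. -/
def smallChain (U V : Set X) (n : ℕ) : Submodule 𝕜 (SingChain 𝕜 X n) :=
  Finsupp.supported 𝕜 𝕜 (smallSing U V n)

lemma single_mem_smallChain {U V : Set X} {n : ℕ} {σ : C(Simp n, X)} (h : σ ∈ smallSing U V n)
    (r : 𝕜) : Finsupp.single σ r ∈ smallChain 𝕜 U V n :=
  Finsupp.single_mem_supported 𝕜 r h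

lemma act_mem_smallChain {U V : Set X} {k n : ℕ} (a : ob 𝕜 k ⟶ ob 𝕜 n) {z : SingChain 𝕜 X n}
    (hz : z ∈ smallChain 𝕜 U V n) : act a z ∈ smallChain 𝕜 U V k := by
  induction a using chain_induction with
  | h0 => simp
  | hadd a b ha hb => rw [map_add]; exact add_mem ha hb
  | hs r w =>
    rw [map_smul]
    refine Submodule.smul_mem _ _ ?_
    rw [act_aff]
    unfold smallChain at hz
    rw [Finsupp.supported_eq_span_single] at hz
    induction hz using Submodule.span_induction with
    | zero => simp
    | add x y _ _ hx hy => rw [Finsupp.mapDomain_add]; exact add_mem hx hy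
    | smul r x _ hx => rw [Finsupp.mapDomain_smul]; exact Submodule.smul_mem _ _ hx
    | mem x hx =>
      obtain ⟨σ, hσ, rfl⟩ := hx
      rw [Finsupp.mapDomain_single]
      refine single_mem_smallChain ?_ _
      have : Set.range (σ.comp (affMap w)) ⊆ Set.range σ := by
        rw [ContinuousMap.coe_comp]; exact Set.range_comp_subset_range _ _
      exact hσ.imp this.trans this.trans

/-- Compare a Lebesgue number of the cover pulled back along σ with the geometric decay of the mesh.
-/
lemma exists_sdPow_single_mem {U V : Set X} (hU : IsOpen U) (hV : IsOpen V)
    (hUV : U ∪ V = Set.univ) {n : ℕ} (σ : C(Simp n, X)) (r : 𝕜) :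
    ∃ k, act (sdPow 𝕜 n k) (Finsupp.single σ r) ∈ smallChain 𝕜 U V n := by
  obtain ⟨ε, hε, hcov⟩ := lebesgue_number_lemma_of_metric (s := (Set.univ : Set (Simp n)))
    (c := fun b : Bool => σ ⁻¹' (bif b then U else V)) isCompact_univ
    (by rintro (_ | _); exacts [hV.preimage σ.continuous, hU.preimage σ.continuous])
    (by
      intro x _
      have : σ x ∈ U ∪ V := hUV ▸ Set.mem_univ _
      rcases this with h | h
      · exact Set.mem_iUnion.2 ⟨true, h⟩
      · exact Set.mem_iUnion.2 ⟨false, h⟩)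
  obtain ⟨k, hk⟩ := exists_pow_lt_of_lt_one hε
    (show (1 - 1 / ((n : ℝ) + 1)) < 1 by
      have : (0 : ℝ) < 1 / ((n : ℝ) + 1) := by positivity
      linarith)
  have h0 : (0 : ℝ) ≤ 1 - 1 / ((n : ℝ) + 1) := by
    rw [sub_nonneg, div_le_one (by positivity)]
    linarith [n.cast_nonneg (α := ℝ)]
  refine ⟨k, ?_⟩
  have := sdPow_mem_affSpan (𝕜 := 𝕜) n k
  generalize sdPow 𝕜 n k = x at this
  induction this using Submodule.span_induction with
  | zero => simp
  | add x y _ _ hx hy => rw [map_add]; exact add_mem hx hy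
  | smul r x _ hx => rw [map_smul]; exact Submodule.smul_mem _ _ hx
  | mem x hx =>
    obtain ⟨w, hw, rfl⟩ := hx
    rw [act_aff, Finsupp.mapDomain_single]
    refine single_mem_smallChain ?_ _
    -- The ball around the image of one vertex contains the whole affine simplex, so one member of
    -- the cover suffices.
    obtain ⟨b, hb⟩ := hcov (affMap w (stdSimplex.vertex 0)) trivial
    have key : ∀ t, affMap w t ∈ Metric.ball (affMap w (stdSimplex.vertex 0)) ε := fun t =>
      (dist_affMap_le (pow_nonneg h0 k) hw _ _).trans_lt hk
    cases b
    · right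
      rintro _ ⟨t, rfl⟩
      exact hb (key t)
    · left
      rintro _ ⟨t, rfl⟩
      exact hb (key t)

lemma sdPow_add_mem {U V : Set X} {n k : ℕ} {z : SingChain 𝕜 X n}
    (hz : act (sdPow 𝕜 n k) z ∈ smallChain 𝕜 U V n) (l : ℕ) :
    act (sdPow 𝕜 n (l + k)) z ∈ smallChain 𝕜 U V n := by
  induction l with
  | zero => simpa using hz
  | succ l ih =>
    rw [show l + 1 + k = (l + k) + 1 by omega, sdPow, act_comp]
    exact act_mem_smallChain _ ih

lemma exists_sdPow_mem {U V : Set X} (hU : IsOpen U) (hV : IsOpen V)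
    (hUV : U ∪ V = Set.univ) {n : ℕ} (z : SingChain 𝕜 X n) :
    ∃ k, act (sdPow 𝕜 n k) z ∈ smallChain 𝕜 U V n := by
  induction z using Finsupp.induction_linear with
  | zero => exact ⟨0, by simp⟩
  | add x y hx hy =>
    obtain ⟨k, hk⟩ := hx
    obtain ⟨l, hl⟩ := hy
    refine ⟨l + k, ?_⟩
    rw [map_add]
    refine add_mem (sdPow_add_mem hk l) ?_
    rw [add_comm l k]
    exact sdPow_add_mem hl k
  | single σ r => exact exists_sdPow_single_mem hU hV hUV σ r

/-- One more subdivision changes a chain y by ∂Ty + T∂y. The first term is a boundary, and the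
second is small because ∂y is small and the action of affine chains preserves smallness. -/
lemma exists_sub_sdPow_mem {U V : Set X} {n : ℕ} {z : SingChain 𝕜 X (n + 1)}
    (hz : act (bd 𝕜 n) z ∈ smallChain 𝕜 U V n) (k : ℕ) :
    ∃ b : SingChain 𝕜 X (n + 2),
      z - act (sdPow 𝕜 (n + 1) k) z - act (bd 𝕜 (n + 1)) b ∈ smallChain 𝕜 U V (n + 1) := by
  induction k with
  | zero => exact ⟨0, by simp [sdPow, act_id]⟩
  | succ k ih =>
    obtain ⟨b, hb⟩ := ih
    set y := act (sdPow 𝕜 (n + 1) k) z with hy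
    have hby : act (bd 𝕜 n) y ∈ smallChain 𝕜 U V n := by
      rw [hy]
      clear_value y
      clear hb hy b y
      have : ∀ k, bd 𝕜 n ≫ sdPow 𝕜 (n + 1) k = sdPow 𝕜 n k ≫ bd 𝕜 n := by
        intro k
        induction k with
        | zero => simp [sdPow]
        | succ k ih => rw [sdPow, ← Category.assoc, bd_sd, Category.assoc, ih, sdPow,
            Category.assoc]
      rw [← act_comp, this, act_comp]
      exact act_mem_smallChain _ hz
    have h := congr(act (X := X) $(bd_sdHomotopy 𝕜 n) y)
    rw [map_add, map_sub, LinearMap.add_apply, LinearMap.sub_apply, act_id, act_comp, act_comp] at h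
    refine ⟨b + act (sdHomotopy 𝕜 (n + 1)) y, ?_⟩
    rw [map_add, sdPow, act_comp, ← hy]
    have e : z - act (sd 𝕜 (n + 1)) y
        - (act (bd 𝕜 (n + 1)) b + act (bd 𝕜 (n + 1)) (act (sdHomotopy 𝕜 (n + 1)) y))
        = (z - y - act (bd 𝕜 (n + 1)) b) + act (sdHomotopy 𝕜 n) (act (bd 𝕜 n) y) := by
      rw [← sub_eq_zero] at h ⊢
      rw [← neg_eq_zero, ← h]
      abel
    rw [e]
    exact add_mem hb (act_mem_smallChain _ hby)

/-- The theorem of small simplices: a chain with small boundary is small up to a boundary. -/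
theorem exists_sub_bd_mem_smallChain {U V : Set X} (hU : IsOpen U) (hV : IsOpen V)
    (hUV : U ∪ V = Set.univ) {n : ℕ} {z : SingChain 𝕜 X (n + 1)}
    (hz : act (bd 𝕜 n) z ∈ smallChain 𝕜 U V n) :
    ∃ b : SingChain 𝕜 X (n + 2), z - act (bd 𝕜 (n + 1)) b ∈ smallChain 𝕜 U V (n + 1) := by
  obtain ⟨k, hk⟩ := exists_sdPow_mem hU hV hUV z
  obtain ⟨b, hb⟩ := exists_sub_sdPow_mem hz k
  refine ⟨b, ?_⟩
  convert add_mem hb hk using 1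
  abel

lemma mem_smallChain_zero {U V : Set X} (hUV : U ∪ V = Set.univ) (z : SingChain 𝕜 X 0) :
    z ∈ smallChain 𝕜 U V 0 := by
  have : smallSing U V 0 = Set.univ := by
    refine Set.eq_univ_of_forall fun σ => ?_
    have hr : Set.range σ ⊆ {σ (stdSimplex.vertex 0)} := by
      rintro _ ⟨t, rfl⟩
      rw [Subsingleton.elim t (stdSimplex.vertex 0)]
      rfl
    have : σ (stdSimplex.vertex 0) ∈ U ∪ V := hUV ▸ Set.mem_univ _
    exact this.imp (fun h => hr.trans (by simpa using h)) (fun h => hr.trans (by simpa using h))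
  rw [smallChain, this, Finsupp.supported_univ]
  trivial

end Action

end
end TropicalGeom

open CategoryTheory

namespace TropicalGeom

universe u
noncomputable section

/-! ### A long exact sequence for complexes that are right exact up to an acyclic complex -/

section LongExact

open Limits HomologicalComplex

variable {R : Type u} [Ring R] {A B C : ChainComplex (ModuleCat.{u} R) ℕ} (f : A ⟶ B) (g : B ⟶ C)

lemma exactAt_of_forall (Q : ChainComplex (ModuleCat.{u} R) ℕ)
    (h0 : ∀ z : Q.X 0, ∃ b : Q.X 1, Q.d 1 0 b = z)
    (h : ∀ n, ∀ z : Q.X (n + 1), Q.d (n + 1) n z = 0 → ∃ b : Q.X (n + 2), Q.d (n + 2) (n + 1) b = z)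
    (n : ℕ) : Q.ExactAt n := by
  cases n with
  | zero =>
    rw [Q.exactAt_iff' 1 0 0 (by simp) (by simp), ShortComplex.moduleCat_exact_iff]
    intro z _
    exact h0 z
  | succ n =>
    rw [Q.exactAt_iff' (n + 2) (n + 1) n (by simp) (by simp), ShortComplex.moduleCat_exact_iff]
    intro z hz
    exact h n z hz

lemma exact_image (S : ShortComplex (ChainComplex (ModuleCat.{u} R) ℕ))
    (hex : ∀ n, ∀ x : S.X₂.X n, S.g.f n x = 0 → ∃ y : S.X₁.X n, S.f.f n y = x) : S.Exact := by
  refine HomologicalComplex.exact_of_degreewise_exact _ fun n => ?_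
  rw [ShortComplex.moduleCat_exact_iff]
  exact hex n

lemma f_surjective_of_epi {P Q : ChainComplex (ModuleCat.{u} R) ℕ} (π : P ⟶ Q) [Epi π] (n : ℕ) :
    Function.Surjective (π.f n) := (ModuleCat.epi_iff_surjective _).1 inferInstance

lemma hom_comm_apply {P Q : ChainComplex (ModuleCat.{u} R) ℕ} (π : P ⟶ Q) (i j : ℕ) (x : P.X i) :
    π.f j (P.d i j x) = Q.d i j (π.f i x) := by
  have := congr($(π.comm i j) x)
  exact this.symm

/-- A cycle of the cokernel lifts to a chain whose boundary lies in the image of `g`; the hypotheses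
make such a chain a boundary modulo that image. -/
lemma cokernel_exactAt
    (h0 : ∀ z : C.X 0, ∃ b : C.X 1, z - C.d 1 0 b ∈ Set.range (g.f 0))
    (h : ∀ n, ∀ z : C.X (n + 1), C.d (n + 1) n z ∈ Set.range (g.f n) →
      ∃ b : C.X (n + 2), z - C.d (n + 2) (n + 1) b ∈ Set.range (g.f (n + 1))) (n : ℕ) :
    (cokernel g).ExactAt n := by
  have hex : (ShortComplex.mk g (cokernel.π g) (by simp)).Exact :=
    ShortComplex.exact_cokernel g
  have hex' : ∀ n, ∀ x : C.X n, (cokernel.π g).f n x = 0 → x ∈ Set.range (g.f n) := by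
    intro n x hx
    have := (HomologicalComplex.exact_iff_degreewise_exact _).1 hex n
    rw [ShortComplex.moduleCat_exact_iff] at this
    exact this x hx
  have hz : ∀ n, ∀ y : B.X n, (cokernel.π g).f n (g.f n y) = 0 := by
    intro n y
    have := congr(($(cokernel.condition g)).f n y)
    exact this
  refine exactAt_of_forall _ ?_ ?_ n
  · intro z
    obtain ⟨z, rfl⟩ := f_surjective_of_epi (cokernel.π g) 0 z
    obtain ⟨b, y, hy⟩ := h0 z
    refine ⟨(cokernel.π g).f 1 b, ?_⟩
    rw [← hom_comm_apply]
    have := hz 0 y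
    rw [hy, map_sub, sub_eq_zero] at this
    exact this.symm
  · intro n z hzz
    obtain ⟨z, rfl⟩ := f_surjective_of_epi (cokernel.π g) (n + 1) z
    rw [← hom_comm_apply] at hzz
    obtain ⟨b, y, hy⟩ := h n z (hex' n _ hzz)
    refine ⟨(cokernel.π g).f (n + 2) b, ?_⟩
    rw [← hom_comm_apply]
    have := hz (n + 1) y
    rw [hy, map_sub, sub_eq_zero] at this
    exact this.symm

/-- Factor `g` through its image. The first factor completes `f` to a short exact sequence, and the
inclusion of the image into C induces isomorphisms in positive degrees because its cokernel is
acyclic. Hence im g can be replaced by C in the long exact sequence. -/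
theorem exists_longExact (w : f ≫ g = 0) (hf : Mono f)
    (hex : ∀ n, ∀ x : B.X n, g.f n x = 0 → ∃ y : A.X n, f.f n y = x)
    (h0 : ∀ z : C.X 0, ∃ b : C.X 1, z - C.d 1 0 b ∈ Set.range (g.f 0))
    (h : ∀ n, ∀ z : C.X (n + 1), C.d (n + 1) n z ∈ Set.range (g.f n) →
      ∃ b : C.X (n + 2), z - C.d (n + 2) (n + 1) b ∈ Set.range (g.f (n + 1))) (j : ℕ) :
    ∃ δ : C.homology (j + 1) →ₗ[R] A.homology j,
      Function.Exact (homologyMap f (j + 1)) (homologyMap g (j + 1)) ∧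
      Function.Exact (homologyMap g (j + 1)) δ ∧ Function.Exact δ (homologyMap f j) := by
  let e := Abelian.factorThruImage g
  let ι := Abelian.image.ι g
  have eι : e ≫ ι = g := Abelian.image.fac g
  have we : f ≫ e = 0 := by
    rw [← cancel_mono ι, Category.assoc, eι, w, zero_comp]
  have S1 : (ShortComplex.mk f e we).ShortExact :=
    { exact := exact_image _ fun n x hx => hex n x (by
        rw [← eι]
        simp only [HomologicalComplex.comp_f, ModuleCat.hom_comp, LinearMap.comp_apply]
        erw [hx]
        simp)
      mono_f := hf
      epi_g := inferInstanceAs (Epi (Abelian.factorThruImage g)) }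
  have S2 : (ShortComplex.mk ι (cokernel.π g) (kernel.condition _)).ShortExact :=
    { exact := ShortComplex.exact_of_f_is_kernel _ (kernelIsKernel _)
      mono_f := inferInstanceAs (Mono (kernel.ι (cokernel.π g)))
      epi_g := inferInstanceAs (Epi (cokernel.π g)) }
  have hz : ∀ n, IsZero ((cokernel g).homology n) := fun n =>
    (cokernel_exactAt g h0 h n).isZero_homology
  -- Both neighbours in the long exact sequence of `S2` are homology of the acyclic cokernel.
  have hiso : IsIso (homologyMap ι (j + 1)) := by
    have h1 : Mono (homologyMap ι (j + 1)) :=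
      (S2.homology_exact₁ (j + 2) (j + 1) (by simp)).mono_g ((hz _).eq_of_src _ _)
    have h2 : Epi (homologyMap ι (j + 1)) :=
      (S2.homology_exact₂ (j + 1)).epi_f ((hz _).eq_of_tgt _ _)
    exact isIso_of_mono_of_epi _
  have hg : homologyMap g (j + 1) = homologyMap e (j + 1) ≫ homologyMap ι (j + 1) := by
    rw [← homologyMap_comp, eι]
  let I := asIso (homologyMap ι (j + 1))
  have hI : ∀ x, homologyMap g (j + 1) x = I.toLinearEquiv (homologyMap e (j + 1) x) := by
    intro x
    rw [hg]
    rfl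
  have E2 := (ShortComplex.ShortExact.moduleCat_exact_iff_function_exact _).1
    (S1.homology_exact₂ (j + 1))
  have E3 := (ShortComplex.ShortExact.moduleCat_exact_iff_function_exact _).1
    (S1.homology_exact₃ (j + 1) j (by simp))
  have E1 := (ShortComplex.ShortExact.moduleCat_exact_iff_function_exact _).1
    (S1.homology_exact₁ (j + 1) j (by simp))
  refine ⟨(S1.δ (j + 1) j (by simp)).hom ∘ₗ I.toLinearEquiv.symm.toLinearMap, ?_, ?_, ?_⟩
  · intro x
    rw [hI, LinearEquiv.map_eq_zero_iff]
    exact E2 x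
  · intro x
    have := E3 (I.toLinearEquiv.symm x)
    refine this.trans ⟨?_, ?_⟩
    · rintro ⟨y, hy⟩
      refine ⟨y, ?_⟩
      rw [hI]
      erw [hy]
      simp
    · rintro ⟨y, hy⟩
      refine ⟨y, ?_⟩
      rw [hI] at hy
      rw [← hy]
      simp
  · intro x
    refine (E1 x).trans ⟨?_, ?_⟩
    · rintro ⟨y, hy⟩
      exact ⟨I.toLinearEquiv y, by simpa using hy⟩
    · rintro ⟨y, hy⟩
      exact ⟨_, hy⟩

end LongExact

end
end TropicalGeom

open CategoryTheory

namespace TropicalGeom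

universe u
noncomputable section

/-! ### Mathlib's singular chain complex -/

section Chains

open Simplicial Opposite

variable (𝕜 : Type u) [Field 𝕜]

/-- The simplicial chains of a simplicial set form a free module. -/
def chainEquiv (Y : SSet.{0}) (n : ℕ) :
    (Y _⦋n⦌ →₀ 𝕜) ≃ₗ[𝕜] (Y.chainComplex (ModuleCat.of 𝕜 𝕜)).X n :=
  LinearEquiv.ofLinearMap
    (Finsupp.linearCombination 𝕜 fun x => (Y.ιChainComplex (R := ModuleCat.of 𝕜 𝕜) x).hom (1 : 𝕜))
    (Limits.Cofan.IsColimit.desc (Y.isColimitChainComplexXCofan (ModuleCat.of 𝕜 𝕜) n)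
      fun x => ModuleCat.ofHom (Finsupp.lsingle x : 𝕜 →ₗ[𝕜] (Y _⦋n⦌ →₀ 𝕜))).hom
    (by
      have : (Limits.Cofan.IsColimit.desc (Y.isColimitChainComplexXCofan (ModuleCat.of 𝕜 𝕜) n)
          fun x => ModuleCat.ofHom (Finsupp.lsingle x : 𝕜 →ₗ[𝕜] (Y _⦋n⦌ →₀ 𝕜))) ≫
          ModuleCat.ofHom (Finsupp.linearCombination 𝕜
            fun x => (Y.ιChainComplex (R := ModuleCat.of 𝕜 𝕜) x).hom (1 : 𝕜)) = 𝟙 _ := by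
        refine Limits.Cofan.IsColimit.hom_ext (Y.isColimitChainComplexXCofan _ n) _ _ fun x => ?_
        rw [Limits.Cofan.IsColimit.fac_assoc]
        ext
        simp
        rfl
      exact congr(($this).hom))
    (by
      ext x : 2
      have := Limits.Cofan.IsColimit.fac (Y.isColimitChainComplexXCofan (ModuleCat.of 𝕜 𝕜) n)
        (fun x => ModuleCat.ofHom (Finsupp.lsingle x : 𝕜 →ₗ[𝕜] (Y _⦋n⦌ →₀ 𝕜))) x
      have := congr($this (1 : 𝕜))
      rw [LinearMap.id_comp, LinearMap.comp_apply, Finsupp.lsingle_apply]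
      erw [LinearMap.comp_apply, Finsupp.linearCombination_single, one_smul]
      exact this)

variable {𝕜}

lemma chainEquiv_single (Y : SSet.{0}) {n : ℕ} (x : Y _⦋n⦌) (r : 𝕜) :
    chainEquiv 𝕜 Y n (Finsupp.single x r) =
      r • (Y.ιChainComplex (R := ModuleCat.of 𝕜 𝕜) x).hom (1 : 𝕜) :=
  Finsupp.linearCombination_single _ _ _

lemma d_chainEquiv_single (Y : SSet.{0}) {n : ℕ} (x : Y _⦋n + 1⦌) (r : 𝕜) :
    (Y.chainComplex (ModuleCat.of 𝕜 𝕜)).d (n + 1) n (chainEquiv 𝕜 Y (n + 1) (Finsupp.single x r)) =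
      chainEquiv 𝕜 Y n (∑ i : Fin (n + 2), (-1 : ℤ) ^ (i : ℕ) • Finsupp.single (Y.δ i x) r) := by
  rw [chainEquiv_single, map_smul, map_sum]
  simp only [map_zsmul, chainEquiv_single]
  have := congr(($(Y.ιChainComplex_d (R := ModuleCat.of 𝕜 𝕜) x)).hom (1 : 𝕜))
  rw [ModuleCat.hom_comp, LinearMap.comp_apply] at this
  erw [this]
  rw [ModuleCat.hom_sum, LinearMap.sum_apply, Finset.smul_sum]
  refine Finset.sum_congr rfl fun i _ => ?_
  rw [ModuleCat.hom_zsmul, LinearMap.smul_apply, smul_comm]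

lemma map_chainEquiv (Y Z : SSet.{0}) (f : Y ⟶ Z) {n : ℕ} (z : Y _⦋n⦌ →₀ 𝕜) :
    (SSet.chainComplexMap f (ModuleCat.of 𝕜 𝕜)).f n (chainEquiv 𝕜 Y n z) =
      chainEquiv 𝕜 Z n (Finsupp.mapDomain (f.app (op ⦋n⦌)) z) := by
  induction z using Finsupp.induction_linear with
  | zero => simp
  | add x y hx hy => rw [map_add, map_add, hx, hy, Finsupp.mapDomain_add, map_add]
  | single x r =>
    rw [Finsupp.mapDomain_single, chainEquiv_single, chainEquiv_single, map_smul]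
    congr 1
    exact congr(($(SSet.ι_chainComplexMap_f Y Z f (ModuleCat.of 𝕜 𝕜) x)).hom (1 : 𝕜))

variable (𝕜) in
/-- The singular chain complex of a space, in Mathlib's version. -/
abbrev singComplex (T : TopCat.{0}) : ChainComplex (ModuleCat.{u} 𝕜) ℕ :=
  (TopCat.toSSet.obj T).chainComplex (ModuleCat.of 𝕜 𝕜)

variable (𝕜) in
/-- The map of singular chain complexes induced by a continuous map. -/
abbrev singMap {S T : TopCat.{0}} (f : S ⟶ T) : singComplex 𝕜 S ⟶ singComplex 𝕜 T :=
  SSet.chainComplexMap (TopCat.toSSet.map f) (ModuleCat.of 𝕜 𝕜)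

/-- The identification of singular simplices. -/
def simplexEquiv (X : TopCat.{0}) (n : ℕ) : (TopCat.toSSet.obj X) _⦋n⦌ ≃ C(Simp n, X) :=
  TopCat.toSSetObjEquiv X (op ⦋n⦌)

lemma simplexEquiv_δ (X : TopCat.{0}) {n : ℕ} (x : (TopCat.toSSet.obj X) _⦋n + 1⦌)
    (i : Fin (n + 2)) : simplexEquiv X n ((TopCat.toSSet.obj X).δ i x) =
      (simplexEquiv X (n + 1) x).comp (affMap (face n i)) := by
  ext t
  change _ = (simplexEquiv X (n + 1) x) (mix t (face n i))
  rw [mix_face]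
  rfl

variable (𝕜) in
/-- The identification of singular chains. -/
def singEquiv (X : TopCat.{0}) (n : ℕ) : SingChain 𝕜 X n ≃ₗ[𝕜] (singComplex 𝕜 X).X n :=
  (Finsupp.domLCongr (simplexEquiv X n).symm).trans (chainEquiv 𝕜 (TopCat.toSSet.obj X) n)

lemma singEquiv_apply (X : TopCat.{0}) {n : ℕ} (z : SingChain 𝕜 X n) :
    singEquiv 𝕜 X n z =
      chainEquiv 𝕜 (TopCat.toSSet.obj X) n (Finsupp.mapDomain (simplexEquiv X n).symm z) := by
  rw [singEquiv, LinearEquiv.trans_apply, Finsupp.domLCongr_apply, Finsupp.domCongr_apply,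
    Finsupp.equivMapDomain_eq_mapDomain]

lemma act_bd {X : Type} [TopologicalSpace X] {n : ℕ} (z : SingChain 𝕜 X (n + 1)) :
    act (bd 𝕜 n) z = ∑ i : Fin (n + 2),
      (-1 : ℤ) ^ (i : ℕ) • Finsupp.mapDomain (fun σ => σ.comp (affMap (face n i))) z := by
  have : act (X := X) (bd 𝕜 n) = ∑ i : Fin (n + 2), (-1 : ℤ) ^ (i : ℕ) • act (aff (face n i)) := by
    rw [bd, map_sum]
    refine Finset.sum_congr rfl fun i _ => ?_
    rcases neg_one_pow_eq_or ℤ (i : ℕ) with h | h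
    · rw [h, one_smul, one_smul]
    · rw [h, neg_smul, neg_smul, one_smul, one_smul, map_neg]
  rw [this, LinearMap.sum_apply]
  refine Finset.sum_congr rfl fun i _ => ?_
  rw [LinearMap.smul_apply, act_aff]

/-- This transports the explicit subdivision calculus to the complex that defines `betti`. -/
lemma singEquiv_d (X : TopCat.{0}) {n : ℕ} (z : SingChain 𝕜 X (n + 1)) :
    (singComplex 𝕜 X).d (n + 1) n (singEquiv 𝕜 X (n + 1) z) = singEquiv 𝕜 X n (act (bd 𝕜 n) z) := by
  induction z using Finsupp.induction_linear with
  | zero => simp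
  | add x y hx hy => simp only [map_add, hx, hy]
  | single σ r =>
    have h1 : singEquiv 𝕜 X (n + 1) (Finsupp.single σ r) =
        chainEquiv 𝕜 (TopCat.toSSet.obj X) (n + 1)
          (Finsupp.single ((simplexEquiv X (n + 1)).symm σ) r) := by
      rw [singEquiv_apply, Finsupp.mapDomain_single]
    rw [h1]
    refine (d_chainEquiv_single _ _ _).trans ?_
    rw [singEquiv_apply, act_bd, Finsupp.mapDomain_finsetSum]
    congr 1
    refine Finset.sum_congr rfl fun i _ => ?_
    rw [Finsupp.mapDomain_single, ← Finsupp.mapDomain.addMonoidHom_apply, map_zsmul,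
      Finsupp.mapDomain.addMonoidHom_apply, Finsupp.mapDomain_single]
    congr 2
    rw [Equiv.eq_symm_apply, simplexEquiv_δ, Equiv.apply_symm_apply]

lemma singEquiv_map {X Y : TopCat.{0}} (f : X ⟶ Y) {n : ℕ} (z : SingChain 𝕜 X n) :
    (singMap 𝕜 f).f n (singEquiv 𝕜 X n z) =
      singEquiv 𝕜 Y n (Finsupp.mapDomain (fun σ => f.hom.comp σ) z) := by
  rw [singEquiv_apply]
  refine (map_chainEquiv _ _ (TopCat.toSSet.map f) _).trans ?_
  rw [singEquiv_apply, ← Finsupp.mapDomain_comp, ← Finsupp.mapDomain_comp]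
  rfl

end Chains

end
end TropicalGeom

open CategoryTheory

namespace TropicalGeom

universe u
noncomputable section

/-! ### The Mayer-Vietoris sequence -/

section Finsupp

/-- Injective pushforward does not cancel coefficients, so the equality forces every basis element
in the support of `a` to come from δ. This is the gluing behind exactness at the middle term of
Mayer-Vietoris. -/
lemma exists_mapDomain_eq {𝕜 α β γ δ : Type*} [Field 𝕜] {pA : α → γ} {pB : β → γ} {qA : δ → α}
    {qB : δ → β} (hB : Function.Injective pB) (hA : Function.Injective pA)
    (hq : ∀ d, pA (qA d) = pB (qB d)) (hp : ∀ a b, pA a = pB b → ∃ d, qA d = a)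
    {a : α →₀ 𝕜} {b : β →₀ 𝕜} (h : Finsupp.mapDomain pA a = Finsupp.mapDomain pB b) :
    ∃ c : δ →₀ 𝕜, Finsupp.mapDomain qA c = a ∧ Finsupp.mapDomain qB c = b := by
  have h1 : a ∈ Finsupp.supported 𝕜 𝕜 (qA '' Set.univ) := by
    intro x hx
    have hx0 : Finsupp.mapDomain pA a (pA x) ≠ 0 := by
      rw [Finsupp.mapDomain_apply hA]
      simpa using hx
    have : pA x ∈ Set.range pB := by
      by_contra hn
      exact hx0 (h ▸ Finsupp.mapDomain_of_notMem_range _ _ hn)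
    obtain ⟨y, hy⟩ := this
    obtain ⟨d, hd⟩ := hp x y hy.symm
    exact ⟨d, trivial, hd⟩
  rw [← Finsupp.lmapDomain_supported] at h1
  obtain ⟨c, -, hc⟩ := h1
  refine ⟨c, hc, Finsupp.mapDomain_injective hB ?_⟩
  rw [← h, ← hc]
  change Finsupp.mapDomain pB (Finsupp.mapDomain qB c) =
    Finsupp.mapDomain pA (Finsupp.mapDomain qA c)
  rw [← Finsupp.mapDomain_comp, ← Finsupp.mapDomain_comp]
  congr 1
  funext d
  exact (hq d).symm

end Finsupp

lemma preimage_union_preimage {P : Type} {A B : Set P} :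
    (Subtype.val ⁻¹' A : Set ↥(A ∪ B)) ∪ Subtype.val ⁻¹' B = Set.univ :=
  Set.eq_univ_of_forall fun x => x.2

section MayerVietoris

open Limits HomologicalComplex

variable (𝕜 : Type u) [Field 𝕜] {P : Type} [TopologicalSpace P]

/-- The inclusion of subspaces. -/
def incl {A B : Set P} (h : A ⊆ B) : TopCat.of A ⟶ TopCat.of B :=
  TopCat.ofHom ⟨Set.inclusion h, continuous_inclusion h⟩

lemma incl_comp {A B C : Set P} (h : A ⊆ B) (h' : B ⊆ C) :
    incl h ≫ incl h' = incl (h.trans h') := rfl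

lemma incl_comp_injective {A B : Set P} (h : A ⊆ B) (n : ℕ) :
    Function.Injective fun σ : C(Simp n, A) => (incl h).hom.comp σ := by
  intro σ τ hst
  ext t
  have := congr(($hst t : P))
  exact this

lemma singMap_comp {S T Z : TopCat.{0}} (f : S ⟶ T) (g : T ⟶ Z) :
    singMap 𝕜 f ≫ singMap 𝕜 g = singMap 𝕜 (f ≫ g) := by
  rw [← Functor.map_comp, ← Functor.map_comp]

variable (A B : Set P)

/-- The complex in the middle of the Mayer-Vietoris sequence. -/
abbrev mvMiddle : ChainComplex (ModuleCat.{u} 𝕜) ℕ :=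
  singComplex 𝕜 (TopCat.of A) ⊞ singComplex 𝕜 (TopCat.of B)

/-- The first map of the Mayer-Vietoris sequence. -/
def mvLeft : singComplex 𝕜 (TopCat.of ↥(A ∩ B)) ⟶ mvMiddle 𝕜 A B :=
  biprod.lift (singMap 𝕜 (incl Set.inter_subset_left)) (-singMap 𝕜 (incl Set.inter_subset_right))

/-- The second map of the Mayer-Vietoris sequence. -/
def mvRight : mvMiddle 𝕜 A B ⟶ singComplex 𝕜 (TopCat.of ↥(A ∪ B)) :=
  biprod.desc (singMap 𝕜 (incl Set.subset_union_left)) (singMap 𝕜 (incl Set.subset_union_right))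

lemma mvLeft_mvRight : mvLeft 𝕜 A B ≫ mvRight 𝕜 A B = 0 := by
  rw [mvLeft, mvRight, biprod.lift_desc, Preadditive.neg_comp, singMap_comp, singMap_comp,
    incl_comp, incl_comp, add_neg_cancel]

variable {A B}

lemma mono_singMap_incl (h : A ⊆ B) : Mono (singMap 𝕜 (incl h)) := by
  refine HomologicalComplex.mono_of_mono_f _ fun n => ?_
  rw [ModuleCat.mono_iff_injective]
  intro x y hxy
  obtain ⟨x, rfl⟩ := (singEquiv 𝕜 _ n).surjective x
  obtain ⟨y, rfl⟩ := (singEquiv 𝕜 _ n).surjective y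
  rw [singEquiv_map, singEquiv_map] at hxy
  congr 1
  exact Finsupp.mapDomain_injective (incl_comp_injective h n) ((singEquiv 𝕜 _ n).injective hxy)

lemma mono_mvLeft : Mono (mvLeft 𝕜 A B) := by
  have := mono_singMap_incl 𝕜 (Set.inter_subset_left (s := A) (t := B))
  have h : mvLeft 𝕜 A B ≫ biprod.fst = singMap 𝕜 (incl Set.inter_subset_left) := biprod.lift_fst _ _
  exact mono_of_mono_fac h

lemma mvMiddle_ext {n : ℕ} (x : (mvMiddle 𝕜 A B).X n) :
    ∃ (a : SingChain 𝕜 A n) (b : SingChain 𝕜 B n),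
      x = (biprod.inl : _ ⟶ mvMiddle 𝕜 A B).f n (singEquiv 𝕜 (TopCat.of A) n a) +
        (biprod.inr : _ ⟶ mvMiddle 𝕜 A B).f n (singEquiv 𝕜 (TopCat.of B) n b) := by
  obtain ⟨a, ha⟩ := (singEquiv 𝕜 _ n).surjective ((biprod.fst : mvMiddle 𝕜 A B ⟶ _).f n x)
  obtain ⟨b, hb⟩ := (singEquiv 𝕜 _ n).surjective ((biprod.snd : mvMiddle 𝕜 A B ⟶ _).f n x)
  refine ⟨a, b, ?_⟩
  rw [ha, hb]
  have := congr(($(biprod.total (X := singComplex 𝕜 (TopCat.of A))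
    (Y := singComplex 𝕜 (TopCat.of B)))).f n x)
  exact this.symm

lemma mvRight_apply {n : ℕ} (a : SingChain 𝕜 A n) (b : SingChain 𝕜 B n) :
    (mvRight 𝕜 A B).f n ((biprod.inl : _ ⟶ mvMiddle 𝕜 A B).f n (singEquiv 𝕜 (TopCat.of A) n a) +
        (biprod.inr : _ ⟶ mvMiddle 𝕜 A B).f n (singEquiv 𝕜 (TopCat.of B) n b)) =
      singEquiv 𝕜 (TopCat.of ↥(A ∪ B)) n
        (Finsupp.mapDomain (fun σ => (incl Set.subset_union_left).hom.comp σ) a +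
          Finsupp.mapDomain (fun σ => (incl Set.subset_union_right).hom.comp σ) b) := by
  rw [map_add, map_add, ← singEquiv_map, ← singEquiv_map]
  congr 1
  · exact congr(($(biprod.inl_desc (singMap 𝕜 (incl (Set.subset_union_left (s := A) (t := B))))
      (singMap 𝕜 (incl (Set.subset_union_right (s := A) (t := B)))))).f n
        (singEquiv 𝕜 (TopCat.of A) n a))
  · exact congr(($(biprod.inr_desc (singMap 𝕜 (incl (Set.subset_union_left (s := A) (t := B))))
      (singMap 𝕜 (incl (Set.subset_union_right (s := A) (t := B)))))).f n
        (singEquiv 𝕜 (TopCat.of B) n b))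

lemma mvLeft_apply {n : ℕ} (c : SingChain 𝕜 ↥(A ∩ B) n) :
    (mvLeft 𝕜 A B).f n (singEquiv 𝕜 (TopCat.of ↥(A ∩ B)) n c) =
      (biprod.inl : _ ⟶ mvMiddle 𝕜 A B).f n (singEquiv 𝕜 (TopCat.of A) n
        (Finsupp.mapDomain (fun σ => (incl Set.inter_subset_left).hom.comp σ) c)) +
        (biprod.inr : _ ⟶ mvMiddle 𝕜 A B).f n (singEquiv 𝕜 (TopCat.of B) n
        (-Finsupp.mapDomain (fun σ => (incl Set.inter_subset_right).hom.comp σ) c)) := by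
  rw [map_neg, ← singEquiv_map, ← singEquiv_map]
  have : mvLeft 𝕜 A B = singMap 𝕜 (incl Set.inter_subset_left) ≫ biprod.inl +
      (-singMap 𝕜 (incl Set.inter_subset_right)) ≫ biprod.inr := biprod.lift_eq
  rw [this]
  rfl

lemma mv_exact {n : ℕ} (x : (mvMiddle 𝕜 A B).X n) (hx : (mvRight 𝕜 A B).f n x = 0) :
    ∃ y, (mvLeft 𝕜 A B).f n y = x := by
  obtain ⟨a, b, rfl⟩ := mvMiddle_ext 𝕜 x
  rw [mvRight_apply, LinearEquiv.map_eq_zero_iff, add_eq_zero_iff_eq_neg] at hx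
  -- The kernel condition reads a = -b in A ∪ B, hence the `-b`; this matches the sign in `mvLeft`.
  obtain ⟨c, hc, hc'⟩ := exists_mapDomain_eq (𝕜 := 𝕜) (α := C(Simp n, A)) (β := C(Simp n, B))
    (δ := C(Simp n, ↥(A ∩ B)))
    (qA := fun σ => (incl (Set.inter_subset_left (s := A) (t := B))).hom.comp σ)
    (qB := fun σ => (incl (Set.inter_subset_right (s := A) (t := B))).hom.comp σ) (b := -b)
    (incl_comp_injective _ n) (incl_comp_injective _ n) (fun d => rfl) (by
      intro σ τ h
      refine ⟨⟨fun t => ⟨σ t, (σ t).2, ?_⟩, by fun_prop⟩, ?_⟩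
      · have : (σ t : P) = τ t := congr(($h t : P))
        rw [this]
        exact (τ t).2
      · ext t
        rfl) (hx.trans (by
          rw [← Finsupp.mapDomain.addMonoidHom_apply, ← Finsupp.mapDomain.addMonoidHom_apply,
            map_neg]))
  refine ⟨singEquiv 𝕜 (TopCat.of ↥(A ∩ B)) n c, ?_⟩
  rw [mvLeft_apply]
  erw [hc, hc']
  rw [neg_neg]

/-- With this description of the image, the theorem of small simplices supplies the hypotheses of
`exists_longExact`. -/
lemma mem_range_mvRight {n : ℕ} (y : SingChain 𝕜 ↥(A ∪ B) n) :
    singEquiv 𝕜 (TopCat.of ↥(A ∪ B)) n y ∈ Set.range ((mvRight 𝕜 A B).f n) ↔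
      y ∈ smallChain 𝕜 (Subtype.val ⁻¹' A : Set ↥(A ∪ B)) (Subtype.val ⁻¹' B) n := by
  constructor
  · rintro ⟨x, hx⟩
    obtain ⟨a, b, rfl⟩ := mvMiddle_ext 𝕜 x
    rw [mvRight_apply] at hx
    rw [← (singEquiv 𝕜 _ n).injective hx]
    clear hx
    refine add_mem ?_ ?_
    · induction a using Finsupp.induction_linear with
      | zero => simp
      | add a b ha hb => rw [Finsupp.mapDomain_add]; exact add_mem ha hb
      | single σ r =>
        rw [Finsupp.mapDomain_single]
        refine single_mem_smallChain (Or.inl ?_) r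
        rintro _ ⟨t, rfl⟩
        exact (σ t).2
    · induction b using Finsupp.induction_linear with
      | zero => simp
      | add a b ha hb => rw [Finsupp.mapDomain_add]; exact add_mem ha hb
      | single σ r =>
        rw [Finsupp.mapDomain_single]
        refine single_mem_smallChain (Or.inr ?_) r
        rintro _ ⟨t, rfl⟩
        exact (σ t).2
  · intro hy
    change _ ∈ LinearMap.range ((mvRight 𝕜 A B).f n).hom
    unfold smallChain at hy
    rw [Finsupp.supported_eq_span_single] at hy
    induction hy using Submodule.span_induction with
    | zero => simp
    | add x y _ _ hx hy => rw [map_add]; exact add_mem hx hy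
    | smul r x _ hx => rw [map_smul]; exact Submodule.smul_mem _ _ hx
    | mem x hx =>
      obtain ⟨σ, hσ, rfl⟩ := hx
      rcases hσ with hσ | hσ
      · have hσ' : ∀ t, (σ t : P) ∈ A := fun t => hσ ⟨t, rfl⟩
        obtain ⟨τ, rfl⟩ : ∃ τ : C(Simp n, A), σ = (incl Set.subset_union_left).hom.comp τ :=
          ⟨⟨fun t => ⟨σ t, hσ' t⟩, by fun_prop⟩, rfl⟩
        beta_reduce
        rw [← Finsupp.mapDomain_single
          (f := fun σ : C(Simp n, A) => (incl (Set.subset_union_left (t := B))).hom.comp σ)]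
        refine ⟨_, (mvRight_apply 𝕜 (Finsupp.single τ 1) 0).trans ?_⟩
        rw [Finsupp.mapDomain_zero, add_zero]
      · have hσ' : ∀ t, (σ t : P) ∈ B := fun t => hσ ⟨t, rfl⟩
        obtain ⟨τ, rfl⟩ : ∃ τ : C(Simp n, B), σ = (incl Set.subset_union_right).hom.comp τ :=
          ⟨⟨fun t => ⟨σ t, hσ' t⟩, by fun_prop⟩, rfl⟩
        beta_reduce
        rw [← Finsupp.mapDomain_single
          (f := fun σ : C(Simp n, B) => (incl (Set.subset_union_right (s := A))).hom.comp σ)]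
        refine ⟨_, (mvRight_apply 𝕜 0 (Finsupp.single τ 1)).trans ?_⟩
        rw [Finsupp.mapDomain_zero, zero_add]

/-- The long exact Mayer-Vietoris sequence of a cover by two relatively open sets. -/
theorem exists_mayerVietoris (hA : IsOpen (Subtype.val ⁻¹' A : Set ↥(A ∪ B)))
    (hB : IsOpen (Subtype.val ⁻¹' B : Set ↥(A ∪ B))) (j : ℕ) :
    ∃ δ : (singComplex 𝕜 (TopCat.of ↥(A ∪ B))).homology (j + 1) →ₗ[𝕜]
        (singComplex 𝕜 (TopCat.of ↥(A ∩ B))).homology j,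
      Function.Exact (homologyMap (mvLeft 𝕜 A B) (j + 1)) (homologyMap (mvRight 𝕜 A B) (j + 1)) ∧
      Function.Exact (homologyMap (mvRight 𝕜 A B) (j + 1)) δ ∧
      Function.Exact δ (homologyMap (mvLeft 𝕜 A B) j) := by
  refine exists_longExact _ _ (mvLeft_mvRight 𝕜 A B) (mono_mvLeft 𝕜) (fun n x hx => mv_exact 𝕜 x hx)
    ?_ ?_ j
  · intro z
    refine ⟨0, ?_⟩
    obtain ⟨z, rfl⟩ := (singEquiv 𝕜 _ 0).surjective z
    rw [map_zero, sub_zero, mem_range_mvRight]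
    exact mem_smallChain_zero preimage_union_preimage z
  · intro n z hz
    obtain ⟨z, rfl⟩ := (singEquiv 𝕜 _ (n + 1)).surjective z
    rw [singEquiv_d, mem_range_mvRight] at hz
    obtain ⟨b, hb⟩ := exists_sub_bd_mem_smallChain hA hB preimage_union_preimage hz
    refine ⟨singEquiv 𝕜 _ (n + 2) b, ?_⟩
    rw [singEquiv_d, ← map_sub, mem_range_mvRight]
    exact hb

end MayerVietoris

end
end TropicalGeom

open CategoryTheory

namespace TropicalGeom

universe u
noncomputable section

/-! ### Betti numbers -/

section Betti

open Limits HomologicalComplex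

variable {𝕜 : Type u} [Field 𝕜]

lemma betti_eq_toENat_rank (j : ℕ) (T : Type) [TopologicalSpace T] :
    betti 𝕜 j T =
      Cardinal.toENat (Module.rank 𝕜 ((singComplex 𝕜 (TopCat.of T)).homology j)) := rfl

lemma betti_eq_zero_iff {j : ℕ} {T : Type} [TopologicalSpace T] :
    betti 𝕜 j T = 0 ↔ Subsingleton ((singComplex 𝕜 (TopCat.of T)).homology j) := by
  rw [betti_eq_toENat_rank, Cardinal.toENat_eq_zero, rank_zero_iff]

lemma homologyMap_singMap_comp {R S T : TopCat.{0}} (f : R ⟶ S) (g : S ⟶ T) (j : ℕ)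
    (x : (singComplex 𝕜 R).homology j) :
    homologyMap (singMap 𝕜 g) j (homologyMap (singMap 𝕜 f) j x) =
      homologyMap (singMap 𝕜 (f ≫ g)) j x := by
  rw [← singMap_comp, homologyMap_comp]
  rfl

lemma singMap_id (T : TopCat.{0}) : singMap 𝕜 (𝟙 T) = 𝟙 _ := by
  rw [singMap, SSet.chainComplexMap, CategoryTheory.Functor.map_id]
  exact CategoryTheory.Functor.map_id _ _

lemma homologyMap_singMap_of_homotopic {S T : TopCat.{0}} {f g : S ⟶ T}
    (h : f.hom.Homotopic g.hom) (j : ℕ) :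
    homologyMap (singMap 𝕜 f) j = homologyMap (singMap 𝕜 g) j :=
  TopCat.Homotopy.congr_homologyMap_singularChainComplexFunctor h.some (ModuleCat.of 𝕜 𝕜) j

/-- Homotopy equivalent spaces have isomorphic homology. -/
def homologyIsoOfHomotopyEquiv {S T : Type} [TopologicalSpace S] [TopologicalSpace T]
    (e : ContinuousMap.HomotopyEquiv S T) (j : ℕ) :
    (singComplex 𝕜 (TopCat.of S)).homology j ≅ (singComplex 𝕜 (TopCat.of T)).homology j where
  hom := homologyMap (singMap 𝕜 (TopCat.ofHom e.toFun)) j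
  inv := homologyMap (singMap 𝕜 (TopCat.ofHom e.invFun)) j
  hom_inv_id := by
    rw [← homologyMap_comp, singMap_comp,
      homologyMap_singMap_of_homotopic
        (f := TopCat.ofHom e.toFun ≫ TopCat.ofHom e.invFun) (g := 𝟙 (TopCat.of S)) e.left_inv, singMap_id,
      homologyMap_id]
  inv_hom_id := by
    rw [← homologyMap_comp, singMap_comp,
      homologyMap_singMap_of_homotopic
        (f := TopCat.ofHom e.invFun ≫ TopCat.ofHom e.toFun) (g := 𝟙 (TopCat.of T)) e.right_inv, singMap_id,
      homologyMap_id]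

lemma betti_congr {S T : Type} [TopologicalSpace S] [TopologicalSpace T]
    (e : ContinuousMap.HomotopyEquiv S T) (j : ℕ) : betti 𝕜 j S = betti 𝕜 j T := by
  rw [betti_eq_toENat_rank, betti_eq_toENat_rank, (homologyIsoOfHomotopyEquiv e j).toLinearEquiv.rank_eq]

lemma betti_of_totallyDisconnected {T : Type} [TopologicalSpace T] [TotallyDisconnectedSpace T]
    {j : ℕ} (hj : j ≠ 0) : betti 𝕜 j T = 0 := by
  rw [betti_eq_zero_iff]
  exact ModuleCat.subsingleton_of_isZero
    (AlgebraicTopology.isZero_singularHomologyFunctor_of_totallyDisconnectedSpace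
      (ModuleCat.{u} 𝕜) j (ModuleCat.of 𝕜 𝕜) (TopCat.of T) hj)

lemma rank_sigma_const (ι : Type) :
    Module.rank 𝕜 (∐ fun _ : ι => ModuleCat.of 𝕜 𝕜 : ModuleCat.{u} 𝕜) =
      Cardinal.lift.{u} (Cardinal.mk ι) := by
  let c : Cofan fun _ : ι => ModuleCat.of 𝕜 𝕜 := Cofan.mk (ModuleCat.of 𝕜 (ι →₀ 𝕜))
    fun i => ModuleCat.ofHom (Finsupp.lsingle i : 𝕜 →ₗ[𝕜] (ι →₀ 𝕜))
  have hc : IsColimit c := Cofan.IsColimit.mk c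
    (fun s => ModuleCat.ofHom (Finsupp.lsum 𝕜 fun i => (s.inj i).hom))
    (fun s i => by
      ext
      simp [c])
    (fun s m hm => by
      apply ModuleCat.hom_ext
      refine Finsupp.lhom_ext' fun i => LinearMap.ext_ring ?_
      have := congr($(hm i) (1 : 𝕜))
      refine this.trans ?_
      simp)
  have e : (∐ fun _ : ι => ModuleCat.of 𝕜 𝕜 : ModuleCat.{u} 𝕜) ≃ₗ[𝕜] (ι →₀ 𝕜) :=
    ((coproductIsCoproduct fun _ : ι => ModuleCat.of 𝕜 𝕜).coconePointUniqueUpToIso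
      hc).toLinearEquiv
  rw [e.rank_eq, rank_finsupp_self]

lemma betti_zero_eq (T : Type) [TopologicalSpace T] :
    betti 𝕜 0 T = Cardinal.toENat (Cardinal.mk (ZerothHomotopy T)) := by
  have e := (TopCat.singularHomology₀Iso (TopCat.of T) (ModuleCat.of 𝕜 𝕜)).toLinearEquiv
  rw [betti, e.rank_eq, rank_sigma_const, Cardinal.toENat_lift]

lemma betti_zero_eq_one_iff {T : Type} [TopologicalSpace T] :
    betti 𝕜 0 T = 1 ↔ PathConnectedSpace T := by
  rw [betti_zero_eq, pathConnectedSpace_iff_zerothHomotopy, Cardinal.toENat_eq_one,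
    Cardinal.eq_one_iff_unique, and_comm]

end Betti

end
end TropicalGeom

open CategoryTheory

namespace TropicalGeom

universe u
noncomputable section

/-! ### Betti numbers and the Mayer-Vietoris sequence -/

section BettiMayerVietoris

open Limits HomologicalComplex

variable {𝕜 : Type u} [Field 𝕜] {P : Type} [TopologicalSpace P] {A B : Set P}

lemma rank_homology_mvMiddle (j : ℕ) :
    Module.rank 𝕜 ((mvMiddle 𝕜 A B).homology j) =
      Module.rank 𝕜 ((singComplex 𝕜 (TopCat.of A)).homology j) +
        Module.rank 𝕜 ((singComplex 𝕜 (TopCat.of B)).homology j) := by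
  have := Limits.preservesBinaryBiproducts_of_preservesBiproducts
    (homologyFunctor (ModuleCat.{u} 𝕜) (ComplexShape.down ℕ) j)
  have e : (mvMiddle 𝕜 A B).homology j ≃ₗ[𝕜]
      (singComplex 𝕜 (TopCat.of A)).homology j × (singComplex 𝕜 (TopCat.of B)).homology j :=
    ((homologyFunctor (ModuleCat.{u} 𝕜) (ComplexShape.down ℕ) j).mapBiprod
      (singComplex 𝕜 (TopCat.of A)) (singComplex 𝕜 (TopCat.of B)) ≪≫
        ModuleCat.biprodIsoProd _ _).toLinearEquiv
  rw [e.rank_eq, rank_prod']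

lemma homologyMap_mvLeft_eq_zero_iff {j : ℕ}
    (x : (singComplex 𝕜 (TopCat.of ↥(A ∩ B))).homology j) :
    homologyMap (mvLeft 𝕜 A B) j x = 0 ↔
      homologyMap (singMap 𝕜 (incl (Set.inter_subset_left (s := A) (t := B)))) j x = 0 ∧
      homologyMap (singMap 𝕜 (incl (Set.inter_subset_right (s := A) (t := B)))) j x = 0 := by
  have e : mvLeft 𝕜 A B = singMap 𝕜 (incl Set.inter_subset_left) ≫ biprod.inl -
      singMap 𝕜 (incl Set.inter_subset_right) ≫ biprod.inr := by
    rw [mvLeft, biprod.lift_eq, Preadditive.neg_comp, sub_eq_add_neg]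
  have e1 : mvLeft 𝕜 A B ≫ biprod.fst = singMap 𝕜 (incl Set.inter_subset_left) :=
    biprod.lift_fst _ _
  have e2 : mvLeft 𝕜 A B ≫ (-biprod.snd) = singMap 𝕜 (incl Set.inter_subset_right) := by
    rw [Preadditive.comp_neg, mvLeft, biprod.lift_snd, neg_neg]
  constructor
  · intro h
    rw [← e1, ← e2, homologyMap_comp, homologyMap_comp, ModuleCat.comp_apply, ModuleCat.comp_apply,
      h, map_zero, map_zero]
    exact ⟨rfl, rfl⟩
  · rintro ⟨h1, h2⟩
    rw [e, homologyMap_sub, homologyMap_comp, homologyMap_comp]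
    have key {M N : ModuleCat.{u} 𝕜} (f g : M ⟶ N) (y : M) : (f - g) y = f y - g y := rfl
    rw [key, ModuleCat.comp_apply, ModuleCat.comp_apply, h1, h2, map_zero, map_zero]
    exact sub_zero _

/-- The kernel of the map `H_j(A ∩ B) → H_j(A) ⊕ H_j(B)`. -/
abbrev mvKer (𝕜 : Type u) [Field 𝕜] (A B : Set P) (j : ℕ) :
    Submodule 𝕜 ((singComplex 𝕜 (TopCat.of ↥(A ∩ B))).homology j) :=
  LinearMap.ker (homologyMap (mvLeft 𝕜 A B) j).hom

variable (hA : IsOpen (Subtype.val ⁻¹' A : Set ↥(A ∪ B)))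
  (hB : IsOpen (Subtype.val ⁻¹' B : Set ↥(A ∪ B)))
include hA hB

/-- The vanishing makes H_{j+1}(A) ⊕ H_{j+1}(B) inject into H_{j+1}(A ∪ B), and the connecting map
identifies the quotient with the kernel in degree j. Rank-nullity holds for cardinals, so no
finiteness is needed. -/
lemma betti_union {j : ℕ} (hW : betti 𝕜 (j + 1) ↥(A ∩ B) = 0) :
    betti 𝕜 (j + 1) ↥(A ∪ B) = betti 𝕜 (j + 1) A + betti 𝕜 (j + 1) B +
      Cardinal.toENat (Module.rank 𝕜 (mvKer 𝕜 A B j)) := by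
  obtain ⟨δ, h1, h2, h3⟩ := exists_mayerVietoris 𝕜 hA hB j
  have hs := betti_eq_zero_iff.1 hW
  have hinj : Function.Injective (homologyMap (mvRight 𝕜 A B) (j + 1)).hom := by
    rw [← LinearMap.ker_eq_bot, LinearMap.ker_eq_bot']
    intro x hx
    obtain ⟨y, rfl⟩ := (h1 x).1 hx
    rw [Subsingleton.elim y 0, map_zero]
  have hr := LinearMap.rank_range_add_rank_ker δ
  have e1 : LinearMap.range δ = mvKer 𝕜 A B j := by
    ext x
    exact (h3 x).symm
  have e2 : LinearMap.ker δ = LinearMap.range (homologyMap (mvRight 𝕜 A B) (j + 1)).hom := by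
    ext x
    exact h2 x
  rw [e1, e2, ← (LinearEquiv.ofInjective _ hinj).rank_eq, rank_homology_mvMiddle] at hr
  rw [betti_eq_toENat_rank, betti_eq_toENat_rank, betti_eq_toENat_rank, ← hr, map_add, map_add,
    add_comm]

lemma betti_union_eq_zero {j : ℕ} (h1 : betti 𝕜 (j + 1) A = 0) (h2 : betti 𝕜 (j + 1) B = 0)
    (hk : mvKer 𝕜 A B j = ⊥) : betti 𝕜 (j + 1) ↥(A ∪ B) = 0 := by
  obtain ⟨δ, -, h2', h3⟩ := exists_mayerVietoris 𝕜 hA hB j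
  have hm : Subsingleton ((mvMiddle 𝕜 A B).homology (j + 1)) := by
    rw [← rank_zero_iff (R := 𝕜), rank_homology_mvMiddle]
    rw [betti_eq_toENat_rank, Cardinal.toENat_eq_zero] at h1 h2
    rw [h1, h2, add_zero]
  rw [betti_eq_zero_iff, subsingleton_iff_forall_eq 0]
  intro x
  have hx : δ x ∈ mvKer 𝕜 A B j := (h3 (δ x)).2 ⟨x, rfl⟩
  rw [hk, Submodule.mem_bot] at hx
  obtain ⟨y, rfl⟩ := (h2' x).1 hx
  rw [Subsingleton.elim y 0, map_zero]

lemma betti_union_eq_zero_of_betti_inter {j : ℕ} (h1 : betti 𝕜 (j + 1) A = 0)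
    (h2 : betti 𝕜 (j + 1) B = 0) (hW : betti 𝕜 j ↥(A ∩ B) = 0) :
    betti 𝕜 (j + 1) ↥(A ∪ B) = 0 := by
  have := betti_eq_zero_iff.1 hW
  exact betti_union_eq_zero hA hB h1 h2 (Subsingleton.elim _ _)

omit hA hB in
lemma mvKer_eq_top {j : ℕ} (h1 : betti 𝕜 j A = 0) (h2 : betti 𝕜 j B = 0) : mvKer 𝕜 A B j = ⊤ := by
  have := betti_eq_zero_iff.1 h1
  have := betti_eq_zero_iff.1 h2
  rw [Submodule.eq_top_iff']
  intro x
  rw [LinearMap.mem_ker]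
  exact (homologyMap_mvLeft_eq_zero_iff x).2 ⟨Subsingleton.elim _ _, Subsingleton.elim _ _⟩

-- Compare with a point. For path connected A and B the maps to H_0(pt) are isomorphisms, so the
-- kernel is the reduced H_0 of A ∩ B. The added 1 avoids truncated subtraction.
omit hA hB in
lemma rank_mvKer_zero (h1 : betti 𝕜 0 A = 1) (h2 : betti 𝕜 0 B = 1) (hne : (A ∩ B).Nonempty) :
    Cardinal.toENat (Module.rank 𝕜 (mvKer 𝕜 A B 0)) + 1 = betti 𝕜 0 ↥(A ∩ B) := by
  let pt : TopCat.{0} := TopCat.of Unit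
  let p (S : Set P) : TopCat.of S ⟶ pt := TopCat.ofHom (.const _ ())
  have hr (T : Type) [TopologicalSpace T] (h : betti 𝕜 0 T = 1) :
      Module.finrank 𝕜 ((singComplex 𝕜 (TopCat.of T)).homology 0) = 1 := by
    rw [betti_eq_toENat_rank, Cardinal.toENat_eq_one] at h
    exact Module.rank_eq_one_iff_finrank_eq_one.1 h
  have hpt := hr Unit (betti_zero_eq_one_iff.2 inferInstance)
  have hsurj (S : Set P) (hS : S.Nonempty) :
      Function.Surjective (homologyMap (singMap 𝕜 (p S)) 0).hom := by
    obtain ⟨s, hs⟩ := hS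
    let i : pt ⟶ TopCat.of S := TopCat.ofHom (.const _ ⟨s, hs⟩)
    intro x
    refine ⟨homologyMap (singMap 𝕜 i) 0 x, (homologyMap_singMap_comp i (p S) 0 x).trans ?_⟩
    have : i ≫ p S = 𝟙 pt := rfl
    rw [this, singMap_id, homologyMap_id]
    rfl
  have hinj (S : Set P) (hS : S.Nonempty) (h : betti 𝕜 0 S = 1) :
      Function.Injective (homologyMap (singMap 𝕜 (p S)) 0).hom := by
    have h' := hr S h
    have := Module.finite_of_finrank_pos (h'.symm ▸ one_pos)
    have := Module.finite_of_finrank_pos (hpt.symm ▸ one_pos)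
    exact (LinearMap.injective_iff_surjective_of_finrank_eq_finrank (h'.trans hpt.symm)).2
      (hsurj S hS)
  have hker : mvKer 𝕜 A B 0 = LinearMap.ker (homologyMap (singMap 𝕜 (p (A ∩ B))) 0).hom := by
    ext x
    rw [LinearMap.mem_ker, LinearMap.mem_ker]
    refine (homologyMap_mvLeft_eq_zero_iff x).trans ?_
    have ea : homologyMap (singMap 𝕜 (p A)) 0
        (homologyMap (singMap 𝕜 (incl (Set.inter_subset_left (s := A) (t := B)))) 0 x) =
        homologyMap (singMap 𝕜 (p (A ∩ B))) 0 x := homologyMap_singMap_comp _ (p A) 0 x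
    have eb : homologyMap (singMap 𝕜 (p B)) 0
        (homologyMap (singMap 𝕜 (incl (Set.inter_subset_right (s := A) (t := B)))) 0 x) =
        homologyMap (singMap 𝕜 (p (A ∩ B))) 0 x := homologyMap_singMap_comp _ (p B) 0 x
    constructor
    · rintro ⟨ha, -⟩
      refine ea.symm.trans ?_
      rw [ha, map_zero]
    · intro hx
      constructor
      · apply hinj A hne.left h1
        rw [map_zero]
        exact ea.trans hx
      · apply hinj B hne.right h2
        rw [map_zero]
        exact eb.trans hx
  have := LinearMap.rank_range_add_rank_ker (homologyMap (singMap 𝕜 (p (A ∩ B))) 0).hom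
  rw [LinearMap.range_eq_top.2 (hsurj _ hne), rank_top,
    Module.rank_eq_one_iff_finrank_eq_one.2 hpt] at this
  rw [hker, betti_eq_toENat_rank, ← this, map_add, add_comm]
  simp

lemma betti_one_union (hW : betti 𝕜 1 ↥(A ∩ B) = 0) (h1 : betti 𝕜 0 A = 1)
    (h2 : betti 𝕜 0 B = 1) (hne : (A ∩ B).Nonempty) :
    betti 𝕜 1 ↥(A ∪ B) = betti 𝕜 1 A + betti 𝕜 1 B + (betti 𝕜 0 ↥(A ∩ B) - 1) := by
  rw [betti_union hA hB hW, ← rank_mvKer_zero h1 h2 hne]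
  congr 1
  -- Only the finiteness of 1 is needed here; the Betti number itself may be ⊤ in `ℕ∞`.
  exact (ENat.addLECancellable_of_ne_top ENat.one_ne_top).add_tsub_cancel_right.symm

lemma betti_union_of_vanishing {j : ℕ} (hW : betti 𝕜 (j + 1) ↥(A ∩ B) = 0) (h1 : betti 𝕜 j A = 0)
    (h2 : betti 𝕜 j B = 0) :
    betti 𝕜 (j + 1) ↥(A ∪ B) =
      betti 𝕜 (j + 1) A + betti 𝕜 (j + 1) B + betti 𝕜 j ↥(A ∩ B) := by
  rw [betti_union hA hB hW, mvKer_eq_top h1 h2, rank_top]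
  rfl

lemma betti_one_union_eq_zero (h1 : betti 𝕜 0 A = 1) (h2 : betti 𝕜 0 B = 1)
    (hW : betti 𝕜 0 ↥(A ∩ B) = 1) (h1' : betti 𝕜 1 A = 0) (h2' : betti 𝕜 1 B = 0) :
    betti 𝕜 1 ↥(A ∪ B) = 0 := by
  have : PathConnectedSpace ↥(A ∩ B) := betti_zero_eq_one_iff.1 hW
  have hne : (A ∩ B).Nonempty := Set.nonempty_coe_sort.1 inferInstance
  have h := rank_mvKer_zero h1 h2 hne
  rw [hW] at h
  have h := ENat.add_left_injective_of_ne_top ENat.one_ne_top (h.trans (zero_add 1).symm)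
  rw [Cardinal.toENat_eq_zero, Submodule.rank_eq_zero] at h
  exact betti_union_eq_zero hA hB h1' h2' h

end BettiMayerVietoris

end
end TropicalGeom

open CategoryTheory

namespace TropicalGeom

universe u
noncomputable section

/-! ### Deformation retracts -/

section Retract

variable {𝕜 : Type u} [Field 𝕜]

/-- The straight-line homotopy from the identity to `r` stays inside U. -/
lemma betti_eq_of_retraction {E : Type} [AddCommGroup E] [Module ℝ E] [TopologicalSpace E]
    [IsTopologicalAddGroup E] [ContinuousSMul ℝ E] {A U : Set E} (hAU : A ⊆ U) (r : E → E)
    (hr : ContinuousOn r U) (hrU : Set.MapsTo r U A) (hrA : ∀ a ∈ A, r a = a)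
    (hseg : ∀ u ∈ U, segment ℝ u (r u) ⊆ U) (j : ℕ) : betti 𝕜 j U = betti 𝕜 j A := by
  have hru : Continuous fun u : U => r u := hr.comp_continuous continuous_subtype_val fun u => u.2
  refine betti_congr ⟨⟨fun u => ⟨r u, hrU u.2⟩, hru.subtype_mk _⟩, ⟨Set.inclusion hAU,
    continuous_inclusion hAU⟩, ⟨ContinuousMap.Homotopy.symm ?_⟩, ?_⟩ j
  · refine ⟨⟨fun p => ⟨(1 - (p.1 : ℝ)) • (p.2 : E) + (p.1 : ℝ) • r p.2, hseg _ p.2.2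
      ⟨1 - p.1, p.1, by linarith [p.1.2.2], p.1.2.1, by ring, rfl⟩⟩, ?_⟩, ?_, ?_⟩
    · refine Continuous.subtype_mk ?_ _
      have ht : Continuous fun p : unitInterval × U => (p.1 : ℝ) :=
        continuous_subtype_val.comp continuous_fst
      exact ((continuous_const.sub ht).smul (continuous_subtype_val.comp continuous_snd)).add
        (ht.smul (hru.comp continuous_snd))
    · intro u
      ext1
      simp
    · intro u
      ext1
      simp
  · have : ContinuousMap.comp ⟨fun u : U => (⟨r u, hrU u.2⟩ : A), hru.subtype_mk _⟩
        ⟨Set.inclusion hAU, continuous_inclusion hAU⟩ = ContinuousMap.id A := by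
      ext1 a
      exact Subtype.ext (hrA a a.2)
    rw [this]

lemma betti_of_starConvex {E : Type} [AddCommGroup E] [Module ℝ E] [TopologicalSpace E]
    [IsTopologicalAddGroup E] [ContinuousSMul ℝ E] {U : Set E} {x : E} (hx : x ∈ U)
    (hU : ∀ u ∈ U, segment ℝ u x ⊆ U) {j : ℕ} (hj : j ≠ 0) : betti 𝕜 j U = 0 := by
  rw [betti_eq_of_retraction (A := {x}) (by simpa using hx) (fun _ => x) continuousOn_const
    (fun _ _ => rfl) (by simp) hU j]
  exact betti_of_totallyDisconnected hj

lemma betti_graphOver {n : ℕ} {f : (Fin n → ℝ) → ℝ} {S : Set (Fin n → ℝ)} (hf : ContinuousOn f S)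
    (j : ℕ) : betti 𝕜 j (graphOver f S) = betti 𝕜 j S := by
  have hc : Continuous fun x : S => f x :=
    hf.comp_continuous continuous_subtype_val fun x => x.2
  let e : graphOver f S ≃ₜ S :=
    { toFun := fun p => ⟨p.1.1, p.2.1⟩
      invFun := fun x => ⟨(x, f x), x.2, rfl⟩
      left_inv := fun p => Subtype.ext (Prod.ext rfl p.2.2.symm)
      right_inv := fun x => rfl
      continuous_toFun := by fun_prop
      continuous_invFun := (continuous_subtype_val.prodMk hc).subtype_mk _ }
  exact betti_congr e.toHomotopyEquiv j

lemma betti_zero_of_isEmpty {T : Type} [TopologicalSpace T] [IsEmpty T] : betti 𝕜 0 T = 0 := by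
  have : IsEmpty (ZerothHomotopy T) := ⟨fun x => by
    induction x with
    | mk x => exact isEmptyElim x⟩
  rw [betti_zero_eq, Cardinal.mk_eq_zero, map_zero]

end Retract

/-! ### Vanishing of the homology of a polyhedral complex above its dimension -/

lemma IsRationalPolyhedron.convex {n : ℕ} {σ : Set (Fin n → ℝ)} (h : IsRationalPolyhedron σ) :
    Convex ℝ σ := by
  obtain ⟨k, A, b, rfl⟩ := h
  rw [Set.ofPred_forall]
  refine convex_iInter fun i => convex_halfSpace_le ⟨fun x y => ?_, fun c x => ?_⟩ _
  · simp [mul_add, Finset.sum_add_distrib]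
  · simp only [Pi.smul_apply, smul_eq_mul, Finset.mul_sum]
    exact Finset.sum_congr rfl fun j _ => by ring

lemma IsRationalPolyhedron.isClosed {n : ℕ} {σ : Set (Fin n → ℝ)} (h : IsRationalPolyhedron σ) :
    IsClosed σ := by
  obtain ⟨k, A, b, rfl⟩ := h
  rw [Set.ofPred_forall]
  exact isClosed_iInter fun i => isClosed_le (by fun_prop) continuous_const

namespace PolyhedralComplex

variable {n : ℕ} (C : PolyhedralComplex n)

lemma isClosed_support : IsClosed C.support :=
  Set.Finite.isClosed_biUnion C.cells.finite_toSet fun σ hσ => (C.cell_rational σ hσ).isClosed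

variable {C}

lemma mem_support {x : Fin n → ℝ} : x ∈ C.support ↔ ∃ σ ∈ C.cells, x ∈ σ := by
  simp [support]

lemma isExposed_of_subset {ρ σ : Set (Fin n → ℝ)} (hρ : ρ ∈ C.cells) (hσ : σ ∈ C.cells)
    (h : ρ ⊆ σ) : IsExposed ℝ σ ρ := by
  have := C.inter_face σ hσ ρ hρ
  rw [Set.inter_eq_right.2 h] at this
  exact this (C.cell_nonempty ρ hρ)

/-- A functional exposing ρ vanishes on the directions of ρ. If these were all directions of σ, it
would be constant on σ and would expose all of σ. -/
lemma polyDim_lt {ρ σ : Set (Fin n → ℝ)} (hρ : ρ ∈ C.cells) (hσ : σ ∈ C.cells) (h : ρ ⊂ σ) :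
    polyDim ρ < polyDim σ := by
  obtain ⟨l, hl⟩ := isExposed_of_subset hρ hσ h.subset (C.cell_nonempty ρ hρ)
  have hle := vectorSpan_mono ℝ h.subset
  refine Submodule.finrank_lt_finrank_of_lt (lt_of_le_of_ne hle fun heq => ?_)
  obtain ⟨y, hyσ, hyρ⟩ := Set.exists_of_ssubset h
  obtain ⟨x, hx⟩ := C.cell_nonempty ρ hρ
  have hker : vectorSpan ℝ ρ ≤ LinearMap.ker (l : (Fin n → ℝ) →ₗ[ℝ] ℝ) := by
    rw [vectorSpan_def, Submodule.span_le]
    rintro _ ⟨a, ha, b, hb, rfl⟩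
    rw [hl] at ha hb
    have h1 := ha.2 b hb.1
    have h2 := hb.2 a ha.1
    change l (a - b) = 0
    rw [map_sub]
    linarith
  have hxy : y - x ∈ vectorSpan ℝ ρ := heq ▸ vsub_mem_vectorSpan ℝ hyσ (h.subset hx)
  have h0 : l (y - x) = 0 := hker hxy
  rw [map_sub, sub_eq_zero] at h0
  apply hyρ
  rw [hl] at hx ⊢
  exact ⟨hyσ, fun z hz => (hx.2 z hz).trans_eq h0.symm⟩

/-! ### Carriers and open stars of cells. -/

variable (C) in
/-- The intersection of the cells that contain `x`, which is the smallest cell that contains `x`. -/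
def carrier (x : Fin n → ℝ) : Set (Fin n → ℝ) := {y | ∀ σ ∈ C.cells, x ∈ σ → y ∈ σ}

lemma mem_carrier (x : Fin n → ℝ) : x ∈ C.carrier x := fun _ _ h => h

lemma carrier_subset {x : Fin n → ℝ} {σ : Set (Fin n → ℝ)} (hσ : σ ∈ C.cells) (hx : x ∈ σ) :
    C.carrier x ⊆ σ := fun _ hy => hy σ hσ hx

/-- Take a minimal cell through x. Its intersection with any other cell through x is a face, hence a
cell through x, so minimality places it inside that other cell. -/
lemma carrier_mem {x : Fin n → ℝ} (hx : x ∈ C.support) : C.carrier x ∈ C.cells := by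
  obtain ⟨σ, hσ, hxσ⟩ := mem_support.1 hx
  have hfin : {ρ | ρ ∈ C.cells ∧ x ∈ ρ}.Finite := C.cells.finite_toSet.subset fun _ h => h.1
  obtain ⟨ρ, hρ⟩ := hfin.exists_minimal ⟨σ, hσ, hxσ⟩
  have : C.carrier x = ρ := by
    refine (carrier_subset hρ.prop.1 hρ.prop.2).antisymm fun y hy κ hκ hxκ => ?_
    have hi : (ρ ∩ κ).Nonempty := ⟨x, hρ.prop.2, hxκ⟩
    have hmem := C.face_mem ρ hρ.prop.1 _ hi (C.inter_face ρ hρ.prop.1 κ hκ hi)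
    exact (hρ.le_of_le ⟨hmem, hρ.prop.2, hxκ⟩ Set.inter_subset_left hy).2
  rw [this]
  exact hρ.prop.1

/-- A cell that contains a point of an open segment with end points in a bigger cell contains the
end points. -/
lemma mem_of_openSegment {ρ σ : Set (Fin n → ℝ)} (hρ : ρ ∈ C.cells) (hσ : σ ∈ C.cells)
    (h : ρ ⊆ σ) {x y z : Fin n → ℝ} (hx : x ∈ σ) (hy : y ∈ σ) (hz : z ∈ ρ)
    (hxyz : z ∈ openSegment ℝ x y) : x ∈ ρ ∧ y ∈ ρ := by
  have he := (isExposed_of_subset hρ hσ h).isExtreme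
  refine ⟨he.2 hx hy hz hxyz, he.2 hy hx hz ?_⟩
  rwa [openSegment_symm]

/-- This produces a relative interior point. Choose x in τ with maximal carrier; for y in τ the
carrier of the midpoint of x and y contains both, so by maximality y already lies in the carrier of
x. -/
lemma exists_carrier_eq {τ : Set (Fin n → ℝ)} (hτ : τ ∈ C.cells) : ∃ x ∈ τ, C.carrier x = τ := by
  have hsupp : ∀ x ∈ τ, x ∈ C.support := fun x hx => mem_support.2 ⟨τ, hτ, hx⟩
  have hfin : (C.carrier '' τ).Finite := C.cells.finite_toSet.subset (by
    rintro _ ⟨x, hx, rfl⟩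
    exact carrier_mem (hsupp x hx))
  obtain ⟨_, hρ⟩ := hfin.exists_maximal ((C.cell_nonempty τ hτ).image _)
  obtain ⟨x, hx, rfl⟩ := hρ.prop
  refine ⟨x, hx, (carrier_subset hτ hx).antisymm fun y hy => ?_⟩
  have hz : midpoint ℝ x y ∈ τ := (C.cell_rational τ hτ).convex.midpoint_mem hx hy
  have hxy := mem_of_openSegment (carrier_mem (hsupp _ hz)) hτ (carrier_subset hτ hz) hx hy
    (mem_carrier _) (midpoint_mem_openSegment x y)
  exact hρ.le_of_ge ⟨_, hz, rfl⟩ (carrier_subset (carrier_mem (hsupp _ hz)) hxy.1) hxy.2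

variable (C) in
/-- The union of the relative interiors of the cells in `Q`. -/
def stars (Q : Finset (Set (Fin n → ℝ))) : Set (Fin n → ℝ) := {x | x ∈ C.support ∧ C.carrier x ∈ Q}

variable (C) in
/-- A set of cells that contains with a cell all cells of which it is a face. -/
def IsUpClosed (Q : Finset (Set (Fin n → ℝ))) : Prop :=
  ∀ σ ∈ Q, σ ∈ C.cells ∧ ∀ ρ ∈ C.cells, σ ⊆ ρ → ρ ∈ Q

-- The cells outside an up-closed set are finitely many closed sets, and what remains of the support
-- is the star set; this makes it relatively open.
open Classical in
lemma stars_eq {Q : Finset (Set (Fin n → ℝ))} (hQ : C.IsUpClosed Q) :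
    C.stars Q = C.support ∩ (⋃ σ ∈ C.cells \ Q, σ)ᶜ := by
  ext x
  simp only [stars, Set.mem_ofPred_eq, Set.mem_inter_iff, Set.mem_compl_iff, Set.mem_iUnion,
    Finset.mem_sdiff, not_exists]
  refine and_congr_right fun hx => ⟨fun h σ hσ hxσ => ?_, fun h => ?_⟩
  · exact hσ.2 ((hQ _ h).2 σ hσ.1 (carrier_subset hσ.1 hxσ))
  · by_contra hn
    exact h _ ⟨carrier_mem hx, hn⟩ (mem_carrier x)

lemma exists_isOpen_stars {Q : Finset (Set (Fin n → ℝ))} (hQ : C.IsUpClosed Q) :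
    ∃ O, IsOpen O ∧ C.stars Q = C.support ∩ O := by
  classical
  refine ⟨_, ?_, stars_eq hQ⟩
  rw [isOpen_compl_iff]
  exact Set.Finite.isClosed_biUnion (Finset.finite_toSet _) fun σ hσ =>
    (C.cell_rational σ (Finset.mem_sdiff.1 hσ).1).isClosed

lemma isOpen_preimage_stars {Q R : Finset (Set (Fin n → ℝ))} (hQ : C.IsUpClosed Q) :
    IsOpen (Subtype.val ⁻¹' C.stars Q : Set ↥(C.stars R)) := by
  obtain ⟨O, hO, h⟩ := exists_isOpen_stars hQ
  convert hO.preimage (continuous_subtype_val (p := fun x => x ∈ C.stars R)) using 1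
  ext x
  simp only [h, Set.mem_preimage, Set.mem_inter_iff, and_iff_right_iff_imp]
  exact fun _ => x.2.1

variable {𝕜 : Type u} [Field 𝕜]

-- The open star is star-shaped about a relative interior point x of τ: inside the segment from y to
-- x the carrier contains both endpoints, hence τ.
open Classical in
lemma betti_openStar {τ : Set (Fin n → ℝ)} (hτ : τ ∈ C.cells) {j : ℕ} (hj : j ≠ 0) :
    betti 𝕜 j ↥(C.stars (C.cells.filter fun σ => τ ⊆ σ)) = 0 := by
  obtain ⟨x, hx, hxτ⟩ := exists_carrier_eq hτ
  have hxs : x ∈ C.support := mem_support.2 ⟨τ, hτ, hx⟩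
  have hxU : x ∈ C.stars (C.cells.filter fun σ => τ ⊆ σ) :=
    ⟨hxs, Finset.mem_filter.2 ⟨carrier_mem hxs, hxτ.ge⟩⟩
  refine betti_of_starConvex hxU (fun y hy z hz => ?_) hj
  have hyσ := Finset.mem_filter.1 hy.2
  rw [← insert_endpoints_openSegment] at hz
  rcases hz with rfl | rfl | hz
  · exact hy
  · exact hxU
  have hzσ : z ∈ C.carrier y := (C.cell_rational _ hyσ.1).convex.openSegment_subset (mem_carrier y)
    (hyσ.2 hx) hz
  have hzs : z ∈ C.support := mem_support.2 ⟨_, hyσ.1, hzσ⟩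
  have := mem_of_openSegment (carrier_mem hzs) hyσ.1 (carrier_subset hyσ.1 hzσ) (mem_carrier y)
    (hyσ.2 hx) (mem_carrier z) hz
  exact ⟨hzs, Finset.mem_filter.2 ⟨carrier_mem hzs,
    hyσ.2.trans (carrier_subset (carrier_mem hzs) this.1)⟩⟩

/-- Remove a minimal cell τ and apply Mayer-Vietoris to the remaining stars and the open star of τ.
They meet in the punctured star, whose cells properly contain τ and so have dimension at least i+1.
The degree drops by one while the lower bound rises by one, which preserves k < j + i; this is why
the bound i is carried along. -/
theorem betti_stars (k : ℕ) (Q : Finset (Set (Fin n → ℝ))) (hQ : C.IsUpClosed Q) (i j : ℕ)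
    (hdim : ∀ σ ∈ Q, i ≤ polyDim σ ∧ polyDim σ ≤ k) (hij : k < j + i) :
    betti 𝕜 j ↥(C.stars Q) = 0 := by
  classical
  induction hc : Q.card using Nat.strong_induction_on generalizing Q i j with
  | _ c ih =>
    subst hc
    rcases Q.eq_empty_or_nonempty with rfl | hne
    · have : IsEmpty ↥(C.stars ∅) := ⟨fun x => by simpa using x.2.2⟩
      rcases Nat.eq_zero_or_pos j with rfl | hj
      · exact betti_zero_of_isEmpty
      · exact betti_of_totallyDisconnected hj.ne'
    obtain ⟨τ, hτ⟩ := Q.exists_minimal hne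
    have hτC := (hQ τ hτ.prop).1
    -- A cell in Q forces i ≤ k, so j is positive.
    obtain ⟨j, rfl⟩ : ∃ j', j = j' + 1 :=
      Nat.exists_eq_succ_of_ne_zero (by have := hdim τ hτ.prop; omega)
    let Qτ := C.cells.filter fun σ => τ ⊆ σ
    have hQτ : C.IsUpClosed Qτ := fun σ hσ => ⟨(Finset.mem_filter.1 hσ).1, fun ρ hρ hσρ =>
      Finset.mem_filter.2 ⟨hρ, (Finset.mem_filter.1 hσ).2.trans hσρ⟩⟩
    have hQe : C.IsUpClosed (Q.erase τ) := fun σ hσ => by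
      obtain ⟨hστ, hσQ⟩ := Finset.mem_erase.1 hσ
      refine ⟨(hQ σ hσQ).1, fun ρ hρ hσρ => Finset.mem_erase.2 ⟨?_, (hQ σ hσQ).2 ρ hρ hσρ⟩⟩
      rintro rfl
      exact hστ (hσρ.antisymm (hτ.le_of_le hσQ hσρ))
    have hunion : C.stars (Q.erase τ) ∪ C.stars Qτ = C.stars Q := by
      ext x
      constructor
      · rintro (hx | hx)
        · exact ⟨hx.1, (Finset.mem_erase.1 hx.2).2⟩
        · exact ⟨hx.1, (hQ τ hτ.prop).2 _ (Finset.mem_filter.1 hx.2).1 (Finset.mem_filter.1 hx.2).2⟩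
      · intro hx
        by_cases h : C.carrier x = τ
        · exact Or.inr ⟨hx.1, Finset.mem_filter.2 ⟨carrier_mem hx.1, h.ge⟩⟩
        · exact Or.inl ⟨hx.1, Finset.mem_erase.2 ⟨h, hx.2⟩⟩
    have hinter : C.stars (Q.erase τ) ∩ C.stars Qτ = C.stars (Qτ.erase τ) := by
      ext x
      constructor
      · rintro ⟨hx, hx'⟩
        exact ⟨hx.1, Finset.mem_erase.2 ⟨(Finset.mem_erase.1 hx.2).1, hx'.2⟩⟩
      · intro hx
        obtain ⟨h1, h2⟩ := Finset.mem_erase.1 hx.2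
        exact ⟨⟨hx.1, Finset.mem_erase.2 ⟨h1, (hQ τ hτ.prop).2 _ (Finset.mem_filter.1 h2).1
          (Finset.mem_filter.1 h2).2⟩⟩, hx.1, h2⟩
    have hsub : Qτ.erase τ ⊆ Q.erase τ := Finset.erase_subset_erase _ fun σ hσ =>
      (hQ τ hτ.prop).2 σ (Finset.mem_filter.1 hσ).1 (Finset.mem_filter.1 hσ).2
    have hlt : (Q.erase τ).card < Q.card := Finset.card_erase_lt_of_mem hτ.prop
    have hQτe : C.IsUpClosed (Qτ.erase τ) := fun σ hσ => by
      obtain ⟨hστ, hσQ⟩ := Finset.mem_erase.1 hσ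
      refine ⟨(hQτ σ hσQ).1, fun ρ hρ hσρ => Finset.mem_erase.2 ⟨?_, (hQτ σ hσQ).2 ρ hρ hσρ⟩⟩
      rintro rfl
      exact hστ (hσρ.antisymm (Finset.mem_filter.1 hσQ).2)
    have h1 : betti 𝕜 (j + 1) ↥(C.stars (Q.erase τ)) = 0 :=
      ih _ hlt _ hQe i (j + 1) (fun σ hσ => hdim σ (Finset.mem_erase.1 hσ).2) hij rfl
    have h2 : betti 𝕜 (j + 1) ↥(C.stars Qτ) = 0 := betti_openStar hτC (by omega)
    have h3 : betti 𝕜 j ↥(C.stars (Q.erase τ) ∩ C.stars Qτ) = 0 := by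
      rw [hinter]
      refine ih _ ((Finset.card_le_card hsub).trans_lt hlt) _ hQτe (i + 1) j (fun σ hσ => ?_)
        (by omega) rfl
      obtain ⟨h1, h2⟩ := Finset.mem_erase.1 hσ
      obtain ⟨h2, h3⟩ := Finset.mem_filter.1 h2
      have := polyDim_lt hτC h2 (h3.ssubset_of_ne h1.symm)
      have h4 := (hdim τ hτ.prop).1
      exact ⟨by omega, (hdim σ (Finset.mem_erase.1 (hsub hσ)).2).2⟩
    have key := betti_union_eq_zero_of_betti_inter (𝕜 := 𝕜) (A := C.stars (Q.erase τ))
      (B := C.stars Qτ) (by rw [hunion]; exact isOpen_preimage_stars hQe)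
      (by rw [hunion]; exact isOpen_preimage_stars hQτ) h1 h2 h3
    rwa [hunion] at key

end PolyhedralComplex

/-- The homology of a tropical variety vanishes above its dimension. -/
theorem TropicalVariety.betti_eq_zero {𝕜 : Type u} [Field 𝕜] {n m : ℕ} (X : TropicalVariety n m)
    {j : ℕ} (hj : m < j) : betti 𝕜 j X.support = 0 := by
  have h : X.toPolyhedralComplex.stars X.cells = X.support := by
    ext x
    exact ⟨fun h => h.1, fun h => ⟨h, PolyhedralComplex.carrier_mem h⟩⟩
  rw [← h]
  refine PolyhedralComplex.betti_stars m X.cells (fun σ hσ => ⟨hσ, fun ρ hρ _ => hρ⟩) 0 j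
    (fun σ hσ => ⟨Nat.zero_le _, ?_⟩) (by omega)
  obtain ⟨τ, -, hτ, hστ⟩ := X.pure σ hσ
  rw [← hτ]
  exact Submodule.finrank_mono (vectorSpan_mono ℝ hστ)

end
end TropicalGeom

open CategoryTheory

namespace TropicalGeom

universe u
noncomputable section

/-! ### Attaching floors along walls -/

section Attach

variable {𝕜 : Type u} [Field 𝕜]

/-- Paste the identity on Y with `r` on W; they agree on the closed overlap. U may be a proper part
of Y ∪ W, so that a wall with one edge removed is covered too. -/
lemma betti_collapse {E : Type} [AddCommGroup E] [Module ℝ E] [TopologicalSpace E]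
    [IsTopologicalAddGroup E] [ContinuousSMul ℝ E] {Y W U : Set E} (hY : IsClosed Y)
    (hW : IsClosed W) (hYU : Y ⊆ U) (hU : U ⊆ Y ∪ W) {r : E → E} (hr : ContinuousOn r W)
    (hrY : ∀ w ∈ W, r w ∈ Y) (hid : ∀ w ∈ W, w ∈ Y → r w = w)
    (hseg : ∀ w ∈ W, w ∈ U → segment ℝ w (r w) ⊆ U) (j : ℕ) : betti 𝕜 j U = betti 𝕜 j Y := by
  classical
  have hW' : ∀ w ∈ W, (if w ∈ Y then w else r w) = r w := by
    intro w hw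
    split_ifs with h
    · exact (hid w hw h).symm
    · rfl
  refine betti_eq_of_retraction hYU (fun w => if w ∈ Y then w else r w) ?_ ?_ ?_ ?_ j
  · refine ContinuousOn.mono ?_ hU
    refine ContinuousOn.union_of_isClosed ?_ ?_ hY hW
    · exact continuousOn_id.congr fun w hw => if_pos hw
    · exact hr.congr hW'
  · intro u hu
    rcases hU hu with h | h
    · simpa only [if_pos h] using h
    · simpa only [hW' u h] using hrY u h
  · intro a ha
    exact if_pos ha
  · intro u hu
    rcases hU hu with h | h
    · rw [if_pos h, segment_same]
      simpa using hYU h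
    · rw [hW' u h]
      exact hseg u h hu

variable {n : ℕ} {S : Set (Fin n → ℝ)} {p q : (Fin n → ℝ) → ℝ}

lemma isClosed_graphDown (hS : IsClosed S) (hp : ContinuousOn p S) : IsClosed (graphDown p S) :=
  (hS.preimage continuous_fst).isClosed_le continuousOn_snd
    (hp.comp continuousOn_fst fun _ h => h)

lemma isClosed_graphUp (hS : IsClosed S) (hp : ContinuousOn p S) : IsClosed (graphUp p S) :=
  (hS.preimage continuous_fst).isClosed_le (hp.comp continuousOn_fst fun _ h => h) continuousOn_snd

lemma graphDown_inter_graphUp_self : graphDown p S ∩ graphUp p S = graphOver p S := by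
  ext z
  simp only [graphDown, graphUp, graphOver, Set.mem_inter_iff, Set.mem_ofPred_eq]
  constructor
  · rintro ⟨⟨h, h1⟩, -, h2⟩
    exact ⟨h, h1.antisymm h2⟩
  · rintro ⟨h, h1⟩
    exact ⟨⟨h, h1.le⟩, h, h1.ge⟩

lemma isClosed_graphOver (hS : IsClosed S) (hp : ContinuousOn p S) : IsClosed (graphOver p S) := by
  rw [← graphDown_inter_graphUp_self]
  exact (isClosed_graphDown hS hp).inter (isClosed_graphUp hS hp)

lemma mem_segment_vertical {x : Fin n → ℝ} {s t : ℝ} {z : (Fin n → ℝ) × ℝ}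
    (hz : z ∈ segment ℝ (x, s) (x, t)) : z.1 = x ∧ z.2 ∈ Set.uIcc s t := by
  rw [← Prod.image_mk_segment_right] at hz
  obtain ⟨y, hy, rfl⟩ := hz
  exact ⟨rfl, segment_eq_uIcc s t ▸ hy⟩

lemma continuousOn_lift {T : Set ((Fin n → ℝ) × ℝ)} (hp : ContinuousOn p S)
    (hT : ∀ z ∈ T, z.1 ∈ S) : ContinuousOn (fun z : (Fin n → ℝ) × ℝ => (z.1, p z.1)) T :=
  continuousOn_fst.prodMk (hp.comp continuousOn_fst hT)

/-- The union of two disjoint sets `Y` (above) and `G` (below) and a wall between them has an open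
cover by a thickening of `Y` and a thickening of `G` that intersect in a thickening of the base `S`
of the wall. -/
lemma exists_wall_cover {Y G : Set ((Fin n → ℝ) × ℝ)} (hY : IsClosed Y) (hG : IsClosed G)
    (hS : IsClosed S) (hp : ContinuousOn p S) (hq : ContinuousOn q S) (hpq : ∀ x ∈ S, q x < p x)
    (hYW : Y ∩ (graphDown p S ∩ graphUp q S) = graphOver p S)
    (hGW : G ∩ (graphDown p S ∩ graphUp q S) = graphOver q S) (hYG : Disjoint Y G) :
    ∃ A B : Set ((Fin n → ℝ) × ℝ), A ∪ B = Y ∪ (graphDown p S ∩ graphUp q S) ∪ G ∧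
      IsOpen (Subtype.val ⁻¹' A : Set ↥(A ∪ B)) ∧ IsOpen (Subtype.val ⁻¹' B : Set ↥(A ∪ B)) ∧
      (∀ j, betti 𝕜 j A = betti 𝕜 j Y) ∧ (∀ j, betti 𝕜 j B = betti 𝕜 j G) ∧
      (∀ j, betti 𝕜 j ↥(A ∩ B) = betti 𝕜 j S) ∧ (S.Nonempty → (A ∩ B).Nonempty) := by
  set W := graphDown p S ∩ graphUp q S with hWdef
  have hW : IsClosed W := (isClosed_graphDown hS hp).inter (isClosed_graphUp hS hq)
  have memW : ∀ z, z ∈ W ↔ z.1 ∈ S ∧ z.2 ≤ p z.1 ∧ q z.1 ≤ z.2 := fun z =>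
    ⟨fun h => ⟨h.1.1, h.1.2, h.2.2⟩, fun h => ⟨⟨h.1, h.2.1⟩, h.1, h.2.2⟩⟩
  have hWY : ∀ z ∈ W, z ∈ Y ↔ z.2 = p z.1 := by
    intro z hz
    constructor
    · intro h
      have : z ∈ graphOver p S := hYW ▸ ⟨h, hz⟩
      exact this.2
    · intro h
      have : z ∈ Y ∩ W := hYW ▸ ⟨((memW z).1 hz).1, h⟩
      exact this.1
  have hWG : ∀ z ∈ W, z ∈ G ↔ z.2 = q z.1 := by
    intro z hz
    constructor
    · intro h
      have : z ∈ graphOver q S := hGW ▸ ⟨h, hz⟩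
      exact this.2
    · intro h
      have : z ∈ G ∩ W := hGW ▸ ⟨((memW z).1 hz).1, h⟩
      exact this.1
  have hYnG : ∀ z ∈ Y, z ∉ G := fun z h => Set.disjoint_left.1 hYG h
  have hun : (Y ∪ W) \ G ∪ (G ∪ W) \ Y = Y ∪ W ∪ G := by
    ext z
    have := hYnG z
    simp only [Set.mem_union, Set.mem_sdiff]
    tauto
  -- The intersection is the wall without its two edges.
  have hint : (Y ∪ W) \ G ∩ ((G ∪ W) \ Y) =
      {z | z.1 ∈ S ∧ q z.1 < z.2 ∧ z.2 < p z.1} := by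
    ext z
    constructor
    · rintro ⟨⟨h1, h2⟩, h3, h4⟩
      have hz : z ∈ W := h1.resolve_left h4
      have hz' := (memW z).1 hz
      refine ⟨hz'.1, lt_of_le_of_ne hz'.2.2 fun h => h2 ((hWG z hz).2 h.symm),
        lt_of_le_of_ne hz'.2.1 fun h => h4 ((hWY z hz).2 h)⟩
    · rintro ⟨h1, h2, h3⟩
      have hz : z ∈ W := (memW z).2 ⟨h1, h3.le, h2.le⟩
      exact ⟨⟨Or.inr hz, fun h => h2.ne' ((hWG z hz).1 h)⟩, Or.inr hz,
        fun h => h3.ne ((hWY z hz).1 h)⟩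
  refine ⟨(Y ∪ W) \ G, (G ∪ W) \ Y, hun, ?_, ?_, fun j => ?_, fun j => ?_, fun j => ?_, ?_⟩
  · convert hG.isOpen_compl.preimage continuous_subtype_val using 1
    ext z
    have := z.2
    have := hYnG z
    simp only [Set.mem_preimage, Set.mem_union, Set.mem_sdiff, Set.mem_compl_iff] at *
    tauto
  · convert hY.isOpen_compl.preimage continuous_subtype_val using 1
    ext z
    have := z.2
    have := hYnG z
    simp only [Set.mem_preimage, Set.mem_union, Set.mem_sdiff, Set.mem_compl_iff] at *
    tauto
  · refine betti_collapse (U := (Y ∪ W) \ G) (r := fun z => (z.1, p z.1)) hY hW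
      (fun z hz => ⟨Or.inl hz, hYnG z hz⟩) Set.sdiff_subset
      (continuousOn_lift hp fun z hz => ((memW z).1 hz).1) (fun z hz => ?_) (fun z hz hzY => ?_)
      (fun z hz hzU => ?_) j
    · obtain ⟨h1, h2, h3⟩ := (memW z).1 hz
      exact (hWY (z.1, p z.1) ((memW (z.1, p z.1)).2 ⟨h1, le_rfl, h3.trans h2⟩)).2 rfl
    · exact Prod.ext rfl ((hWY z hz).1 hzY).symm
    · intro y hy
      obtain ⟨h1, h2, h3⟩ := (memW z).1 hz
      obtain ⟨e1, e2⟩ := mem_segment_vertical (x := z.1) (s := z.2) (t := p z.1) hy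
      rw [Set.uIcc_of_le h2] at e2
      have hyW : y ∈ W := (memW y).2 ⟨by rwa [e1], by rw [e1]; exact e2.2, by
        rw [e1]; exact h3.trans e2.1⟩
      refine ⟨Or.inr hyW, fun hyG => hzU.2 ((hWG z hz).2 (le_antisymm ?_ h3))⟩
      have := (hWG y hyW).1 hyG
      rw [e1] at this
      exact e2.1.trans this.le
  · refine betti_collapse (U := (G ∪ W) \ Y) (r := fun z => (z.1, q z.1)) hG hW
      (fun z hz => ⟨Or.inl hz, fun h => hYnG z h hz⟩) Set.sdiff_subset
      (continuousOn_lift hq fun z hz => ((memW z).1 hz).1) (fun z hz => ?_) (fun z hz hzG => ?_)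
      (fun z hz hzU => ?_) j
    · obtain ⟨h1, h2, h3⟩ := (memW z).1 hz
      exact (hWG (z.1, q z.1) ((memW (z.1, q z.1)).2 ⟨h1, h3.trans h2, le_rfl⟩)).2 rfl
    · exact Prod.ext rfl ((hWG z hz).1 hzG).symm
    · intro y hy
      obtain ⟨h1, h2, h3⟩ := (memW z).1 hz
      obtain ⟨e1, e2⟩ := mem_segment_vertical (x := z.1) (s := z.2) (t := q z.1) hy
      rw [Set.uIcc_of_ge h3] at e2
      have hyW : y ∈ W := (memW y).2 ⟨by rwa [e1], by rw [e1]; exact e2.2.trans h2, by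
        rw [e1]; exact e2.1⟩
      refine ⟨Or.inr hyW, fun hyY => hzU.2 ((hWY z hz).2 (le_antisymm h2 ?_))⟩
      have := (hWY y hyW).1 hyY
      rw [e1] at this
      exact this.ge.trans e2.2
  -- The open wall retracts onto its middle section, a graph over S.
  · have hmid : ContinuousOn (fun x => (p x + q x) / 2) S := (hp.add hq).div_const 2
    rw [hint, betti_eq_of_retraction (A := graphOver (fun x => (p x + q x) / 2) S) ?_
      (fun z => (z.1, (p z.1 + q z.1) / 2)) (continuousOn_lift hmid fun z hz => hz.1) ?_ ?_ ?_ j,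
      betti_graphOver hmid]
    · rintro ⟨x, t⟩ ⟨hx, ht⟩
      have := hpq x hx
      dsimp only at hx ht
      exact ⟨hx, by dsimp only; linarith, by dsimp only; linarith⟩
    · intro z hz
      exact ⟨hz.1, rfl⟩
    · intro z hz
      exact Prod.ext rfl hz.2.symm
    · intro z hz y hy
      obtain ⟨e1, e2⟩ := mem_segment_vertical (x := z.1) (s := z.2) (t := (p z.1 + q z.1) / 2) hy
      have hsub : Set.uIcc z.2 ((p z.1 + q z.1) / 2) ⊆ Set.Ioo (q z.1) (p z.1) := by
        have := hpq z.1 hz.1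
        exact Set.ordConnected_Ioo.uIcc_subset hz.2 ⟨by linarith, by linarith⟩
      have h3 := hsub e2
      rw [← e1] at h3
      exact ⟨e1 ▸ hz.1, h3.1, h3.2⟩
  · rintro ⟨x, hx⟩
    rw [hint]
    have := hpq x hx
    exact ⟨(x, (p x + q x) / 2), hx, by dsimp only; linarith, by dsimp only; linarith⟩

end Attach

/-! ### The floors of a construction pattern -/

lemma HasDivisor.continuousOn {n m : ℕ} {X : TropicalVariety n m} {f : (Fin n → ℝ) → ℝ}
    {Dpos Dneg : TropicalVariety n (m - 1)} (h : HasDivisor X f Dpos Dneg) :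
    ContinuousOn f X.support := by
  obtain ⟨S, a, hS, -, -, -, haff, -⟩ := h
  have hU : (⋃ σ : {σ // σ ∈ S.cells}, σ.1) = X.support := by
    rw [← hS, PolyhedralComplex.support, Set.iUnion_subtype]
  rw [← hU]
  refine LocallyFinite.continuousOn_iUnion (locallyFinite_of_finite _)
    (fun σ => (S.cell_rational σ.1 σ.2).isClosed) fun σ => ?_
  obtain ⟨c, hc⟩ := haff σ.1 σ.2
  exact ContinuousOn.congr (by fun_prop) hc

namespace ConstructionPattern

variable {n m d : ℕ} (K : ConstructionPattern n m d)

/-- The wall over `D i` between the graphs of `f i` and `f (i + 1)`. -/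
def innerWall (i : ℕ) : Set ((Fin n → ℝ) × ℝ) :=
  graphDown (K.f i) (K.D i).support ∩ graphUp (K.f (i + 1)) (K.D i).support

/-- The graphs of `f 1, …, f (i + 1)` together with the walls between them. -/
def floors (i : ℕ) : Set ((Fin n → ℝ) × ℝ) :=
  {z | (∃ j, 1 ≤ j ∧ j ≤ i + 1 ∧ z ∈ graphOver (K.f j) (K.X j).support) ∨
    ∃ j, 1 ≤ j ∧ j ≤ i ∧ z ∈ K.innerWall j}

lemma floors_zero : K.floors 0 = graphOver (K.f 1) (K.X 1).support := by
  ext z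
  constructor
  · rintro (⟨j, h1, h2, hz⟩ | ⟨j, h1, h2, hz⟩)
    · obtain rfl : j = 1 := by omega
      exact hz
    · omega
  · exact fun hz => Or.inl ⟨1, le_rfl, le_rfl, hz⟩

lemma floors_succ (i : ℕ) : K.floors (i + 1) =
    K.floors i ∪ K.innerWall (i + 1) ∪ graphOver (K.f (i + 2)) (K.X (i + 2)).support := by
  ext z
  constructor
  · rintro (⟨j, h1, h2, hz⟩ | ⟨j, h1, h2, hz⟩)
    · rcases Nat.lt_or_ge j (i + 2) with h | h
      · exact Or.inl (Or.inl (Or.inl ⟨j, h1, by omega, hz⟩))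
      · obtain rfl : j = i + 2 := by omega
        exact Or.inr hz
    · rcases Nat.lt_or_ge j (i + 1) with h | h
      · exact Or.inl (Or.inl (Or.inr ⟨j, h1, by omega, hz⟩))
      · obtain rfl : j = i + 1 := by omega
        exact Or.inl (Or.inr hz)
  · rintro (((⟨j, h1, h2, hz⟩ | ⟨j, h1, h2, hz⟩) | hz) | hz)
    · exact Or.inl ⟨j, h1, by omega, hz⟩
    · exact Or.inr ⟨j, h1, by omega, hz⟩
    · exact Or.inr ⟨i + 1, by omega, le_rfl, hz⟩
    · exact Or.inl ⟨i + 2, by omega, le_rfl, hz⟩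

variable {K}

lemma continuousOn_f {i : ℕ} (h1 : 1 ≤ i) (h2 : i ≤ d) : ContinuousOn (K.f i) (K.X i).support :=
  (K.divisor i (Finset.mem_Icc.2 ⟨h1, h2⟩)).continuousOn

lemma D_subset {i : ℕ} (h1 : 1 ≤ i) (h2 : i ≤ d) : (K.D i).support ⊆ (K.X i).support :=
  K.subset_right i (Finset.mem_Icc.2 ⟨h1, h2⟩)

lemma D_subset_succ {i : ℕ} (h2 : i + 1 ≤ d) : (K.D i).support ⊆ (K.X (i + 1)).support :=
  K.subset_left (i + 1) (Finset.mem_Icc.2 ⟨by omega, h2⟩)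

lemma isClosed_floors {i : ℕ} (hi : i + 1 ≤ d) : IsClosed (K.floors i) := by
  induction i with
  | zero =>
    rw [floors_zero]
    exact isClosed_graphOver (K.X 1).isClosed_support (continuousOn_f le_rfl hi)
  | succ i ih =>
    rw [floors_succ]
    refine ((ih (by omega)).union ((isClosed_graphDown (K.D _).isClosed_support ?_).inter
      (isClosed_graphUp (K.D _).isClosed_support ?_))).union
      (isClosed_graphOver (K.X _).isClosed_support (continuousOn_f (by omega) hi))
    · exact (continuousOn_f (by omega) (by omega)).mono (D_subset (by omega) (by omega))
    · exact (continuousOn_f (by omega) (by omega)).mono (D_subset_succ (by omega))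

/-! ### Relative heights of the floors. -/

variable (hf : ∀ i ∈ Finset.Icc 1 d, ∀ j ∈ Finset.Icc 1 d, i < j →
      ∀ p ∈ (K.X i).support ∩ (K.X j).support, K.f j p < K.f i p)
include hf

lemma f_lt {i j : ℕ} (hi : 1 ≤ i) (hij : i < j) (hj : j ≤ d) {x : Fin n → ℝ}
    (hx : x ∈ (K.X i).support) (hx' : x ∈ (K.X j).support) : K.f j x < K.f i x :=
  hf i (Finset.mem_Icc.2 ⟨hi, by omega⟩) j (Finset.mem_Icc.2 ⟨by omega, hj⟩) hij x ⟨hx, hx'⟩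

lemma f_le {i j : ℕ} (hi : 1 ≤ i) (hij : i ≤ j) (hj : j ≤ d) {x : Fin n → ℝ}
    (hx : x ∈ (K.X i).support) (hx' : x ∈ (K.X j).support) : K.f j x ≤ K.f i x := by
  rcases hij.eq_or_lt with rfl | h
  · exact le_rfl
  · exact (f_lt hf hi h hj hx hx').le

/-- A wall point is compared through its lower edge, which lies on floor j+1 ≤ i+1. With k = i+1
this confines the contact with the next wall to its top edge; the strict version below, with k =
i+2, gives disjointness from the next floor. -/
lemma le_of_mem_floors {i k : ℕ} (hik : i + 1 ≤ k) (hk : k ≤ d) {z : (Fin n → ℝ) × ℝ}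
    (hz : z ∈ K.floors i) (hx : z.1 ∈ (K.X k).support) : K.f k z.1 ≤ z.2 := by
  rcases hz with ⟨j, h1, h2, hz⟩ | ⟨j, h1, h2, hz⟩
  · rw [hz.2]
    exact f_le hf h1 (by omega) hk hz.1 hx
  · exact (f_le hf (by omega) (by omega) hk (D_subset_succ (by omega) hz.1.1) hx).trans hz.2.2

lemma lt_of_mem_floors {i k : ℕ} (hik : i + 1 < k) (hk : k ≤ d) {z : (Fin n → ℝ) × ℝ}
    (hz : z ∈ K.floors i) (hx : z.1 ∈ (K.X k).support) : K.f k z.1 < z.2 := by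
  rcases hz with ⟨j, h1, h2, hz⟩ | ⟨j, h1, h2, hz⟩
  · rw [hz.2]
    exact f_lt hf h1 (by omega) hk hz.1 hx
  · exact (f_lt hf (by omega) (by omega) hk (D_subset_succ (by omega) hz.1.1) hx).trans_le hz.2.2

lemma mem_floors_le {i : ℕ} (hi : i + 1 ≤ d) {z : (Fin n → ℝ) × ℝ}
    (hz : z ∈ K.floors i) (hx : z.1 ∈ (K.X 1).support) : z.2 ≤ K.f 1 z.1 := by
  rcases hz with ⟨j, h1, h2, hz⟩ | ⟨j, h1, h2, hz⟩
  · rw [hz.2]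
    exact f_le hf le_rfl h1 (by omega) hx hz.1
  · exact hz.1.2.trans (f_le hf le_rfl h1 (by omega) hx (D_subset h1 (by omega) hz.1.1))

/-! ### Betti numbers, adding one floor at a time. -/

variable {𝕜 : Type u} [Field 𝕜]

lemma exists_floors_cover {i : ℕ} (hi : i + 2 ≤ d) :
    ∃ A B : Set ((Fin n → ℝ) × ℝ), A ∪ B = K.floors (i + 1) ∧
      IsOpen (Subtype.val ⁻¹' A : Set ↥(A ∪ B)) ∧ IsOpen (Subtype.val ⁻¹' B : Set ↥(A ∪ B)) ∧
      (∀ j, betti 𝕜 j A = betti 𝕜 j ↥(K.floors i)) ∧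
      (∀ j, betti 𝕜 j B = betti 𝕜 j (K.X (i + 2)).support) ∧
      (∀ j, betti 𝕜 j ↥(A ∩ B) = betti 𝕜 j (K.D (i + 1)).support) ∧ (A ∩ B).Nonempty := by
  have hD1 : (K.D (i + 1)).support ⊆ (K.X (i + 1)).support := D_subset (by omega) (by omega)
  have hD2 : (K.D (i + 1)).support ⊆ (K.X (i + 2)).support := D_subset_succ hi
  have hlt := K.lt (i + 1) (Finset.mem_Icc.2 ⟨by omega, by omega⟩)
  have hf2 : ContinuousOn (K.f (i + 2)) (K.X (i + 2)).support := continuousOn_f (by omega) hi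
  have hYW : K.floors i ∩ (graphDown (K.f (i + 1)) (K.D (i + 1)).support ∩
      graphUp (K.f (i + 2)) (K.D (i + 1)).support) =
      graphOver (K.f (i + 1)) (K.D (i + 1)).support := by
    ext z
    constructor
    · rintro ⟨hz, hzW⟩
      exact ⟨hzW.1.1, hzW.1.2.antisymm (le_of_mem_floors hf le_rfl (by omega) hz (hD1 hzW.1.1))⟩
    · rintro ⟨hz1, hz2⟩
      exact ⟨Or.inl ⟨i + 1, by omega, le_rfl, hD1 hz1, hz2⟩, ⟨hz1, hz2.le⟩, hz1,
        (hlt _ hz1).le.trans hz2.ge⟩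
  have hGW : graphOver (K.f (i + 2)) (K.X (i + 2)).support ∩
      (graphDown (K.f (i + 1)) (K.D (i + 1)).support ∩
        graphUp (K.f (i + 2)) (K.D (i + 1)).support) =
      graphOver (K.f (i + 2)) (K.D (i + 1)).support := by
    ext z
    constructor
    · rintro ⟨hz, hzW⟩
      exact ⟨hzW.1.1, hz.2⟩
    · rintro ⟨hz1, hz2⟩
      exact ⟨⟨hD2 hz1, hz2⟩, ⟨hz1, hz2.trans_le (hlt _ hz1).le⟩, hz1, hz2.ge⟩
  have hYG : Disjoint (K.floors i) (graphOver (K.f (i + 2)) (K.X (i + 2)).support) := by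
    rw [Set.disjoint_left]
    rintro z hz ⟨hz1, hz2⟩
    exact (lt_of_mem_floors hf (by omega) hi hz hz1).ne' hz2
  obtain ⟨A, B, h1, h2, h3, h4, h5, h6, h7⟩ := exists_wall_cover (𝕜 := 𝕜)
    (isClosed_floors (K := K) (i := i) (by omega))
    (isClosed_graphOver (K.X (i + 2)).isClosed_support hf2) (K.D (i + 1)).isClosed_support
    ((continuousOn_f (by omega) (by omega)).mono hD1) (hf2.mono hD2) hlt hYW hGW hYG
  refine ⟨A, B, h1.trans (floors_succ K i).symm, h2, h3, h4, fun j => ?_, h6,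
    h7 (K.nonempty (i + 1) (Finset.mem_Icc.2 ⟨by omega, by omega⟩))⟩
  rw [h5, betti_graphOver hf2]

lemma betti_floorComposed (j : ℕ) :
    betti 𝕜 j ↥K.floorComposed = betti 𝕜 j ↥(K.floors (d - 1)) := by
  obtain ⟨e, rfl⟩ : ∃ e, d = e + 1 := ⟨d - 1, by have := K.one_le; omega⟩
  rw [Nat.add_sub_cancel]
  have hD0 : (K.D 0).support ⊆ (K.X 1).support := D_subset_succ (by omega)
  have hDd : (K.D (e + 1)).support ⊆ (K.X (e + 1)).support := D_subset (by omega) le_rfl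
  have hf1 : ContinuousOn (K.f 1) (K.D 0).support :=
    (continuousOn_f le_rfl (by omega)).mono hD0
  have hfd : ContinuousOn (K.f (e + 1)) (K.D (e + 1)).support :=
    (continuousOn_f (by omega) le_rfl).mono hDd
  have hcF : IsClosed (K.floors e) := isClosed_floors le_rfl
  have hc0 : IsClosed (graphUp (K.f 1) (K.D 0).support) :=
    isClosed_graphUp (K.D 0).isClosed_support hf1
  have heq : K.floorComposed = K.floors e ∪ graphUp (K.f 1) (K.D 0).support ∪
      graphDown (K.f (e + 1)) (K.D (e + 1)).support := by
    have hw0 : K.wall 0 = graphUp (K.f 1) (K.D 0).support := if_pos rfl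
    have hwd : K.wall (e + 1) = graphDown (K.f (e + 1)) (K.D (e + 1)).support := by
      rw [wall, if_neg (by omega), if_pos rfl]
    have hwi : ∀ i, 1 ≤ i → i ≤ e → K.wall i = K.innerWall i := fun i h1 h2 => by
      rw [wall, if_neg (by omega), if_neg (by omega), innerWall]
    ext z
    simp only [floorComposed, Set.mem_union, Set.mem_iUnion, Finset.mem_Icc]
    constructor
    · rintro (hz | ⟨i, ⟨h1, h2⟩, hz | hz⟩)
      · exact Or.inl (Or.inr (hw0 ▸ hz))
      · exact Or.inl (Or.inl (Or.inl ⟨i, h1, h2, hz⟩))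
      · rcases h2.eq_or_lt with rfl | h2
        · exact Or.inr (hwd ▸ hz)
        · exact Or.inl (Or.inl (Or.inr ⟨i, h1, by omega, hwi i h1 (by omega) ▸ hz⟩))
    · rintro (((⟨i, h1, h2, hz⟩ | ⟨i, h1, h2, hz⟩) | hz) | hz)
      · exact Or.inr ⟨i, ⟨h1, h2⟩, Or.inl hz⟩
      · exact Or.inr ⟨i, ⟨h1, by omega⟩, Or.inr ((hwi i h1 h2).symm ▸ hz)⟩
      · exact Or.inl (hw0.symm ▸ hz)
      · exact Or.inr ⟨e + 1, ⟨by omega, le_rfl⟩, Or.inr (hwd.symm ▸ hz)⟩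
  -- The bottom wall is collapsed first, with the top wall still attached; then the top wall is
  -- collapsed onto the floors.
  rw [heq, betti_collapse (hcF.union hc0)
    (isClosed_graphDown (K.D (e + 1)).isClosed_support hfd) Set.subset_union_left subset_rfl
    (continuousOn_lift hfd fun z hz => hz.1) ?_ ?_ ?_ j,
    betti_collapse hcF hc0 Set.subset_union_left subset_rfl
      (continuousOn_lift hf1 fun z hz => hz.1) ?_ ?_ ?_ j]
  · exact fun z hz => Or.inl ⟨1, le_rfl, by omega, hD0 hz.1, rfl⟩
  · exact fun z hz hzF => Prod.ext rfl
      (hz.2.antisymm (mem_floors_le hf le_rfl hzF (hD0 hz.1)))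
  · intro z hz _ y hy
    obtain ⟨e1, e2⟩ := mem_segment_vertical (x := z.1) (s := z.2) (t := K.f 1 z.1) hy
    rw [Set.uIcc_of_ge hz.2] at e2
    exact Or.inr ⟨e1 ▸ hz.1, e1.symm ▸ e2.1⟩
  · exact fun z hz => Or.inl (Or.inl ⟨e + 1, by omega, le_rfl, hDd hz.1, rfl⟩)
  · rintro z hz (hzF | hz0)
    · exact Prod.ext rfl ((le_of_mem_floors hf le_rfl le_rfl hzF (hDd hz.1)).antisymm hz.2)
    -- Over a common point of D_0 and D_d the two rays can meet only at height f_d, because f_d ≤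
    -- f_1 there.
    · exact Prod.ext rfl (((f_le hf le_rfl (by omega) le_rfl (hD0 hz0.1) (hDd hz.1)).trans
        hz0.2).antisymm hz.2)
  · intro z hz _ y hy
    obtain ⟨e1, e2⟩ := mem_segment_vertical (x := z.1) (s := z.2) (t := K.f (e + 1) z.1) hy
    rw [Set.uIcc_of_le hz.2] at e2
    exact Or.inr ⟨e1 ▸ hz.1, e1.symm ▸ e2.2⟩

variable (hX : ∀ i ∈ Finset.Icc 1 d, IsHomologyBouquet 𝕜 m (K.X i).support)
include hX

lemma betti_zero_floors {i : ℕ} (hi : i + 1 ≤ d) : betti 𝕜 0 ↥(K.floors i) = 1 := by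
  induction i with
  | zero =>
    rw [floors_zero, betti_graphOver (continuousOn_f le_rfl hi)]
    exact (hX 1 (Finset.mem_Icc.2 ⟨le_rfl, hi⟩)).1
  | succ i ih =>
    obtain ⟨A, B, h1, -, -, h4, h5, -, h7⟩ := exists_floors_cover hf (𝕜 := 𝕜) (i := i) hi
    have hA : betti 𝕜 0 A = 1 := (h4 0).trans (ih (by omega))
    have hB : betti 𝕜 0 B = 1 := (h5 0).trans (hX (i + 2) (Finset.mem_Icc.2 ⟨by omega, hi⟩)).1
    rw [← h1]
    rw [betti_zero_eq_one_iff, ← isPathConnected_iff_pathConnectedSpace] at hA hB ⊢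
    exact hA.union hB h7

lemma betti_one_floors (hm : m = 1) {i : ℕ} (hi : i + 1 ≤ d) :
    betti 𝕜 1 ↥(K.floors i) = ∑ k ∈ Finset.Icc 1 (i + 1), betti 𝕜 1 (K.X k).support +
      ∑ k ∈ Finset.Icc 1 i, (betti 𝕜 0 (K.D k).support - 1) := by
  induction i with
  | zero =>
    rw [floors_zero, betti_graphOver (continuousOn_f le_rfl hi)]
    simp
  | succ i ih =>
    obtain ⟨A, B, h1, h2, h3, h4, h5, h6, h7⟩ := exists_floors_cover hf (𝕜 := 𝕜) (i := i) hi
    -- Here D_{i+1} has dimension m - 1 = 0, so its H_1 vanishes.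
    have h := betti_one_union (𝕜 := 𝕜) h2 h3
      ((h6 1).trans ((K.D (i + 1)).betti_eq_zero (by omega)))
      ((h4 0).trans (betti_zero_floors hf hX (by omega)))
      ((h5 0).trans (hX (i + 2) (Finset.mem_Icc.2 ⟨by omega, hi⟩)).1) h7
    rw [h1, h4, h5, h6, ih (by omega)] at h
    rw [h, Finset.sum_Icc_succ_top (show 1 ≤ i + 1 + 1 by omega) fun k => betti 𝕜 1 (K.X k).support,
      Finset.sum_Icc_succ_top (show 1 ≤ i + 1 by omega) fun k => betti 𝕜 0 (K.D k).support - 1]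
    ac_rfl

variable (hD : ∀ i ∈ Finset.Icc 1 (d - 1), IsHomologyBouquet 𝕜 (m - 1) (K.D i).support)
include hD

lemma isHomologyBouquet_floors (hm : 2 ≤ m) {i : ℕ} (hi : i + 1 ≤ d) :
    IsHomologyBouquet 𝕜 m ↥(K.floors i) := by
  refine ⟨betti_zero_floors hf hX hi, ?_⟩
  induction i with
  | zero =>
    rw [floors_zero]
    intro j hj hjm
    rw [betti_graphOver (continuousOn_f le_rfl hi)]
    exact (hX 1 (Finset.mem_Icc.2 ⟨le_rfl, hi⟩)).2 j hj hjm
  | succ i ih =>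
    intro j hj hjm
    obtain ⟨A, B, h1, h2, h3, h4, h5, h6, h7⟩ := exists_floors_cover hf (𝕜 := 𝕜) (i := i) hi
    have hXi := hX (i + 2) (Finset.mem_Icc.2 ⟨by omega, hi⟩)
    have hDi := hD (i + 1) (Finset.mem_Icc.2 ⟨by omega, by omega⟩)
    have hA : betti 𝕜 j A = 0 := (h4 j).trans (ih (by omega) j hj hjm)
    have hB : betti 𝕜 j B = 0 := (h5 j).trans (hXi.2 j hj hjm)
    rw [← h1]
    obtain ⟨j, rfl⟩ : ∃ j', j = j' + 1 := ⟨j - 1, by omega⟩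
    -- Degree one is special: H_0 of the wall's base is not zero, but it injects since the base is
    -- path connected.
    rcases j with _ | j
    · exact betti_one_union_eq_zero h2 h3 ((h4 0).trans (betti_zero_floors hf hX (by omega)))
        ((h5 0).trans hXi.1) ((h6 0).trans hDi.1) hA hB
    · exact betti_union_eq_zero_of_betti_inter h2 h3 hA hB
        ((h6 _).trans (hDi.2 _ (by omega) (by omega)))

lemma betti_top_floors (hm : 2 ≤ m) {i : ℕ} (hi : i + 1 ≤ d) :
    betti 𝕜 m ↥(K.floors i) = ∑ k ∈ Finset.Icc 1 (i + 1), betti 𝕜 m (K.X k).support +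
      ∑ k ∈ Finset.Icc 1 i, betti 𝕜 (m - 1) (K.D k).support := by
  induction i with
  | zero =>
    rw [floors_zero, betti_graphOver (continuousOn_f le_rfl hi)]
    simp
  | succ i ih =>
    obtain ⟨A, B, h1, h2, h3, h4, h5, h6, h7⟩ := exists_floors_cover hf (𝕜 := 𝕜) (i := i) hi
    have hmm : m - 1 + 1 = m := by omega
    -- As m ≥ 2, degree m - 1 is positive and below m, so both pieces have no homology there and all
    -- of H_{m-1}(D_{i+1}) contributes.
    have h := betti_union_of_vanishing (𝕜 := 𝕜) (j := m - 1) h2 h3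
      ((h6 _).trans ((K.D (i + 1)).betti_eq_zero (by omega)))
      ((h4 _).trans ((isHomologyBouquet_floors hf hX hD hm (by omega)).2 _ (by omega) (by omega)))
      ((h5 _).trans ((hX (i + 2) (Finset.mem_Icc.2 ⟨by omega, hi⟩)).2 _ (by omega) (by omega)))
    rw [hmm, h1, h4, h5, h6, ih (by omega)] at h
    rw [h, Finset.sum_Icc_succ_top (show 1 ≤ i + 1 + 1 by omega) fun k => betti 𝕜 m (K.X k).support,
      Finset.sum_Icc_succ_top (show 1 ≤ i + 1 by omega) fun k => betti 𝕜 (m - 1) (K.D k).support]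
    ac_rfl

end ConstructionPattern

end
end TropicalGeom

theorem mainTheorem10 {𝕜 : Type*} [Field 𝕜] {n m d : ℕ}
    (K : TropicalGeom.ConstructionPattern n m d)
    (hX : ∀ i ∈ Finset.Icc 1 d, TropicalGeom.IsHomologyBouquet 𝕜 m (K.X i).support)
    (hf : ∀ i ∈ Finset.Icc 1 d, ∀ j ∈ Finset.Icc 1 d, i < j →
      ∀ p ∈ (K.X i).support ∩ (K.X j).support, K.f j p < K.f i p) :
    (m = 1 →
      TropicalGeom.betti 𝕜 1 K.floorComposed =
        (∑ i ∈ Finset.Icc 1 d, TropicalGeom.betti 𝕜 1 (K.X i).support) +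
          ∑ i ∈ Finset.Icc 1 (d - 1), (TropicalGeom.betti 𝕜 0 (K.D i).support - 1)) ∧
    (2 ≤ m →
      (∀ i ∈ Finset.Icc 1 (d - 1),
        TropicalGeom.IsHomologyBouquet 𝕜 (m - 1) (K.D i).support) →
      TropicalGeom.IsHomologyBouquet 𝕜 m K.floorComposed ∧
      TropicalGeom.betti 𝕜 m K.floorComposed =
        (∑ i ∈ Finset.Icc 1 d, TropicalGeom.betti 𝕜 m (K.X i).support) +
          ∑ i ∈ Finset.Icc 1 (d - 1), TropicalGeom.betti 𝕜 (m - 1) (K.D i).support) := by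
  have hd : d - 1 + 1 = d := Nat.sub_add_cancel K.one_le
  refine ⟨fun hm => ?_, fun hm hD => ⟨⟨?_, fun j hj hjm => ?_⟩, ?_⟩⟩
  · rw [K.betti_floorComposed hf, K.betti_one_floors hf hX hm hd.le, hd]
  · rw [K.betti_floorComposed hf]
    exact K.betti_zero_floors hf hX hd.le
  · rw [K.betti_floorComposed hf]
    exact (K.isHomologyBouquet_floors hf hX hD hm hd.le).2 j hj hjm
  · rw [K.betti_floorComposed hf, K.betti_top_floors hf hX hD hm hd.le, hd]
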